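/- Let $\mathbb U_1$ be the bounded Urysohn space of diameter $1$, i.e. the (unique up to isometry) complete separable metric space of diameter $1$ that embeds every finite metric space of diameter at most $1$ and is homogeneous in the sense that every isometric map from a finite subset of $\mathbb U_1$ into $\mathbb U_1$ extends to an isometry of $\mathbb U_1$ onto itself. Let $\mathrm{Isom}(\mathbb U_1)$ be its group of (surjective) isometries. For $A,B,C\subseteq\mathbb U_1$, say that $A$ and $C$ are independent over $B$ if for all $a\in A$, $c\in C$ with $d(a,c)<1$ there is some $b\in B$ with $d(a,c)=d(a,b)+d(b,c)$. Say that $h\in\mathrm{Isom}(\mathbb U_1)$ moves almost maximally if for every finite $X\subset\mathbb U_1$ and every $a\in\mathbb U_1$ there is a realisation $b$ of the type of $a$ over $X$ (that is, a point $b\in\mathbb U_1$ with $d(b,x)=d(a,x)$ for all $x\in X$) such that $\{b\}$ and $\{h(b)\}$ are independent over $X$. Let $g\in\mathrm{Isom}(\mathbb U_1)$ and suppose that $d(a,g(a))=1$ for some $a\in\mathbb U_1$. Then some product of $2^5$ conjugates of $g$ in $\mathrm{Isom}(\mathbb U_1)$ moves almost maximally. Moreover, every element of $\mathrm{Isom}(\mathbb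 U_1)$ is a product of $2^9$ elements of $\mathrm{Isom}(\mathbb U_1)$ each of which is a conjugate of $g$ or of $g^{-1}$. -/

import Mathlib

namespace BoundedUrysohn

/-- `U` is (a copy of) the bounded Urysohn space of diameter `1`: the complete, separable,
homogeneous metric space of diameter `1` that embeds every finite metric space of diameter
at most `1`. Homogeneous means that every isometric map from a finite subset of `U` to `U`
extends to an isometry of `U` onto itself. -/
structure IsBoundedUrysohn (U : Type*) [MetricSpace U] : Prop where
  complete : CompleteSpace U
  separable : TopologicalSpace.SeparableSpace U
  diam_eq_one : Metric.diam (Set.univ : Set U) = 1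
  homogeneous : ∀ A : Set U, A.Finite → ∀ f : A → U, Isometry f →
    ∃ φ : U ≃ᵢ U, ∀ x : A, φ x = f x
  universal : ∀ (F : Type) [MetricSpace F] [Finite F], (∀ x y : F, dist x y ≤ 1) →
    ∃ f : F → U, Isometry f

variable {U : Type*} [MetricSpace U]

/-- `A` and `C` are independent over `B`: for all `a ∈ A`, `c ∈ C` at distance less than `1`
there is some `b ∈ B` lying metrically between `a` and `c`. -/
def Indep (A B C : Set U) : Prop :=
  ∀ a ∈ A, ∀ c ∈ C, dist a c < 1 → ∃ b ∈ B, dist a c = dist a b + dist b c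

/-- `b` realises the type `tp(a/X)`: `b` has the same distances to the points of `X` as `a`.
In the bounded Urysohn space this says, for finite `X`, that an isometry of the space which
fixes `X` pointwise moves `a` to `b`; see `realisesType_iff`. -/
def RealisesType (X : Set U) (a b : U) : Prop :=
  ∀ x ∈ X, dist b x = dist a x

/-- `g` moves almost maximally: every type `tp(a/X)` over a finite set `X` has a
realisation `b` such that `b` and `g b` are independent over `X`. -/
def MovesAlmostMaximally (g : U ≃ᵢ U) : Prop :=
  ∀ X : Set U, X.Finite → ∀ a : U, ∃ b : U, RealisesType X a b ∧ Indep {b} X {g b}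

/-- Over a finite set, types are the orbits of the pointwise stabiliser. -/
theorem realisesType_iff (hU : IsBoundedUrysohn U) {X : Set U} (hX : X.Finite) (a b : U) :
    RealisesType X a b ↔ ∃ φ : U ≃ᵢ U, (∀ x ∈ X, φ x = x) ∧ φ a = b := by
  classical
  constructor
  · intro h
    by_cases haX : a ∈ X
    · have hab : b = a := dist_eq_zero.1 (by rw [h a haX, dist_self])
      exact ⟨1, fun _ _ => rfl, hab.symm⟩
    · have hne : ∀ x ∈ X, x ≠ a := fun x hx hxa => haX (hxa ▸ hx)
      obtain ⟨φ, hφ⟩ := hU.homogeneous (insert a X) (hX.insert a)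
        (fun x => if (x : U) = a then b else x) (by
          refine Isometry.of_dist_eq ?_
          rintro ⟨x, rfl | hx⟩ ⟨y, rfl | hy⟩
          · simp
          · simpa [hne y hy, Subtype.dist_eq] using h y hy
          · simpa [hne x hx, Subtype.dist_eq, dist_comm] using h x hx
          · simp [hne x hx, hne y hy, Subtype.dist_eq])
      refine ⟨φ, fun x hx => ?_, ?_⟩
      · simpa [hne x hx] using hφ ⟨x, Set.mem_insert_of_mem a hx⟩
      · simpa using hφ ⟨a, Set.mem_insert a X⟩
  · rintro ⟨φ, hφ, rfl⟩ x hx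
    conv_lhs => rw [← hφ x hx]
    exact φ.dist_eq a x

end BoundedUrysohn

/-!
*The product of `2 ^ 5` conjugates.* For `x, y ∈ X` the displacement `d(b, w b)` is bounded by `1`
and by `d(b, x) + d(w x, y) + d(y, b)`. Say that `w` displaces types up to `c` if over every finite
`X` every type has a realisation `b` for which one of these bounds is attained or
`d(b, w b) ≥ c` (`DisplacesTypes`). For `c ≥ 1` this implies that `w` moves almost maximally. If `g`
moves some point by distance `1`, then it displaces types up to `1/4`
(`IsBoundedUrysohn.displacesTypes`): a type at distance at least `1/4` from its base has a
realisation `z` moved by at least `1/4`, and an arbitrary type is displaced by comparing the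
distances of a realisation to `z` and to `g z`. Multiplying `v` with a suitable conjugate of itself
doubles `c` (`DisplacesTypes.exists_double`): if `u` is conjugate to `v` and `b` is far from `v b`
and from `u⁻¹ b`, then `u⁻¹ b` can be moved over all relevant points so that its distance to `v b` is as large as possible,
namely the sum of the two displacements, or the length of a shortest path through the base. The
conjugator is the limit of isometries that are frozen on growing finite sets; it takes care of
the types over finite sets in a countable dense set, and approximate displacement of all types
implies exact displacement because `U` is complete.

*All isometries.* If `h` moves almost maximally, then so it does with finite sets in place of points
(`MovesAlmostMaximally.exists_indep_image`). Consequently a product `u₄ u₃ u₂ u₁` of four conjugates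
that is prescribed on a finite set `E` can be prescribed on any larger finite set, provided the
images `X₀ = E, X₁, …, X₄` satisfy two independence conditions
(`IsBoundedUrysohn.exists_four_conj`), and these hold for some enlargement of any `E`
(`exists_walkGood`). Given `f`, two such products `s` and `t` with `s = f t` are built together,
extending them alternately: `t` is enlarged to satisfy the independence conditions and `s`, which
satisfied them before, is extended to match `f t`. Hence `f = s t⁻¹` is a product of eight
conjugates of `h` and `h⁻¹`.

Types, conjugates and extensions are handled throughout by isometries of the whole space: by
homogeneity, a finite partial isometry is an isometry of `U` of which only the values on a finite
set matter.
-/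

namespace BoundedUrysohn

open Filter Topology

variable {U : Type*} [MetricSpace U]

/-! ### Points and isometries of the bounded Urysohn space -/

theorem IsBoundedUrysohn.dist_le_one (hU : IsBoundedUrysohn U) (x y : U) : dist x y ≤ 1 := by
  rw [← hU.diam_eq_one]
  refine Metric.dist_le_diam_of_mem' ?_ (Set.mem_univ x) (Set.mem_univ y)
  intro h
  have h1 := hU.diam_eq_one
  rw [Metric.diam, h] at h1
  simp at h1

theorem IsBoundedUrysohn.nonempty (hU : IsBoundedUrysohn U) : Nonempty U := by
  by_contra h
  rw [not_nonempty_iff] at h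
  have h1 := hU.diam_eq_one
  rw [Set.univ_eq_empty_iff.2 h, Metric.diam_empty] at h1
  exact zero_ne_one h1

/-- A map that preserves distances on a finite set agrees there with an isometry of the space. -/
theorem IsBoundedUrysohn.exists_extend (hU : IsBoundedUrysohn U) {A : Set U} (hA : A.Finite)
    (f : U → U) (hf : ∀ x ∈ A, ∀ y ∈ A, dist (f x) (f y) = dist x y) :
    ∃ φ : U ≃ᵢ U, ∀ x ∈ A, φ x = f x := by
  obtain ⟨φ, hφ⟩ := hU.homogeneous A hA (fun x => f x)
    (Isometry.of_dist_eq fun x y => hf x x.2 y y.2)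
  exact ⟨φ, fun x hx => hφ ⟨x, hx⟩⟩

/-- Two isometries can be glued along finite sets between which they preserve distances. -/
theorem IsBoundedUrysohn.exists_glue (hU : IsBoundedUrysohn U) {A C : Set U} (hA : A.Finite)
    (hC : C.Finite) (φ ρ : U ≃ᵢ U) (h : ∀ a ∈ A, ∀ c ∈ C, dist (φ a) (ρ c) = dist a c) :
    ∃ ψ : U ≃ᵢ U, (∀ a ∈ A, ψ a = φ a) ∧ ∀ c ∈ C, ψ c = ρ c := by
  classical
  obtain ⟨ψ, hψ⟩ := hU.exists_extend (hA.union hC) (fun x => if x ∈ A then φ x else ρ x) (by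
    intro x hx y hy
    by_cases hxA : x ∈ A <;> by_cases hyA : y ∈ A
    · simp only [hxA, hyA, if_true, φ.dist_eq]
    · simpa [hxA, hyA] using h x hxA y (hy.resolve_left hyA)
    · simpa [hxA, hyA, dist_comm] using h y hyA x (hx.resolve_left hxA)
    · simp only [hxA, hyA, if_false, ρ.dist_eq])
  refine ⟨ψ, fun a ha => by simpa [ha] using hψ a (Or.inl ha), fun c hc => ?_⟩
  rw [hψ c (Or.inr hc)]
  by_cases hcA : c ∈ A
  · have := h c hcA c hc
    rw [dist_self] at this
    simpa [hcA] using dist_eq_zero.1 this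
  · simp [hcA]

/-- Every one-point extension of a finite subset, given by its distance function `f`
(a Katětov function with values at most `1`), is realised in the space. -/
theorem IsBoundedUrysohn.exists_dist_eq (hU : IsBoundedUrysohn U) {F : Set U} (hF : F.Finite)
    (f : U → ℝ) (h1 : ∀ x ∈ F, f x ≤ 1) (h2 : ∀ x ∈ F, ∀ y ∈ F, f x ≤ f y + dist x y)
    (h3 : ∀ x ∈ F, ∀ y ∈ F, dist x y ≤ f x + f y) : ∃ b : U, ∀ x ∈ F, dist b x = f x := by
  classical
  by_cases h0 : ∃ x ∈ F, f x = 0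
  · obtain ⟨x, hx, hx0⟩ := h0
    refine ⟨x, fun y hy => le_antisymm ?_ ?_⟩
    · have := h3 x hx y hy
      linarith
    · have := h2 y hy x hx
      rw [dist_comm y x] at this
      linarith
  · push Not at h0
    have hpos : ∀ x ∈ F, 0 < f x := fun x hx => by
      have := h3 x hx x hx
      rw [dist_self] at this
      exact lt_of_le_of_ne (by linarith) (h0 x hx).symm
    obtain ⟨n, ⟨e⟩⟩ : ∃ n, Nonempty (F ≃ Fin n) :=
      ⟨hF.toFinset.card, ⟨(Equiv.subtypeEquivRight (by simp)).trans hF.toFinset.equivFin⟩⟩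
    let p : Fin n → U := fun i => (e.symm i : U)
    have hp : ∀ i, p i ∈ F := fun i => (e.symm i).2
    let δ : Option (Fin n) → Option (Fin n) → ℝ := fun
      | none, none => 0
      | none, some i => f (p i)
      | some i, none => f (p i)
      | some i, some j => dist (p i) (p j)
    let M : MetricSpace (Option (Fin n)) :=
      { dist := δ
        dist_self := by rintro (_ | i) <;> simp [δ]
        dist_comm := by rintro (_ | i) (_ | j) <;> simp [δ, dist_comm]
        dist_triangle := by
          rintro (_ | i) (_ | j) (_ | k) <;> simp only [δ]
          · simp
          · simp
          · have := hpos _ (hp j)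
            linarith
          · have := h2 _ (hp k) _ (hp j)
            rwa [dist_comm (p k)] at this
          · simp
          · exact h3 _ (hp i) _ (hp k)
          · have := h2 _ (hp i) _ (hp j)
            linarith
          · exact dist_triangle _ _ _
        eq_of_dist_eq_zero := by
          rintro (_ | i) (_ | j) h
          · rfl
          · exact absurd h (hpos _ (hp j)).ne'
          · exact absurd h (hpos _ (hp i)).ne'
          · have h' : p i = p j := dist_eq_zero.1 h
            exact congrArg some (e.symm.injective (Subtype.ext h')) }
    obtain ⟨j, hj⟩ := hU.universal (Option (Fin n)) (by
      rintro (_ | i) (_ | k)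
      · exact zero_le_one
      · exact h1 _ (hp k)
      · exact h1 _ (hp i)
      · exact hU.dist_le_one _ _)
    obtain ⟨φ, hφ⟩ := hU.homogeneous F hF (fun x => j (some (e x))) (by
      refine Isometry.of_dist_eq fun x y => ?_
      rw [hj.dist_eq]
      change dist (p (e x)) (p (e y)) = _
      simp [p, Subtype.dist_eq])
    refine ⟨φ.symm (j none), fun x hx => ?_⟩
    rw [← φ.dist_eq, φ.apply_symm_apply, hφ ⟨x, hx⟩, hj.dist_eq]
    change f (p (e ⟨x, hx⟩)) = f x
    simp [p]

/-! ### Calculus of independence -/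

theorem Indep.symm {A B C : Set U} (h : Indep A B C) : Indep C B A := by
  intro c hc a ha hlt
  obtain ⟨b, hb, hd⟩ := h a ha c hc (by rwa [dist_comm])
  exact ⟨b, hb, by rw [dist_comm c a, dist_comm c b, dist_comm b a, hd, add_comm]⟩

theorem Indep.mono {A A' B C C' : Set U} (h : Indep A B C) (hA : A' ⊆ A) (hC : C' ⊆ C) :
    Indep A' B C' := fun a ha c hc => h a (hA ha) c (hC hc)

theorem indep_of_subset {A B C : Set U} (h : A ⊆ B) : Indep A B C :=
  fun a ha c _ _ => ⟨a, h ha, by simp⟩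

theorem Indep.union_left {A A' B C : Set U} (h : Indep A B C) (h' : Indep A' B C) :
    Indep (A ∪ A') B C := by
  rintro a (ha | ha) c hc hlt
  · exact h a ha c hc hlt
  · exact h' a ha c hc hlt

theorem Indep.union_right {A B C C' : Set U} (h : Indep A B C) (h' : Indep A B C') :
    Indep A B (C ∪ C') := (h.symm.union_left h'.symm).symm

/-- Independence is shown by a lower bound on distances, as the triangle inequality gives the
other half of the equation. -/
theorem indep_of_le {A B C : Set U}
    (h : ∀ a ∈ A, ∀ c ∈ C, 1 ≤ dist a c ∨ ∃ b ∈ B, dist a b + dist b c ≤ dist a c) :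
    Indep A B C := by
  intro a ha c hc hlt
  obtain h | ⟨b, hb, hd⟩ := h a ha c hc
  · linarith
  · exact ⟨b, hb, le_antisymm (dist_triangle _ _ _) hd⟩

/-- Transitivity: the base `D` may be replaced by a base over which `D` is independent. -/
theorem Indep.trans {A B C D : Set U} (h : Indep A D C) (h' : Indep D B C) : Indep A B C := by
  refine indep_of_le fun a ha c hc => ?_
  by_cases hlt : dist a c < 1
  · right
    obtain ⟨d, hd, e⟩ := h a ha c hc hlt
    obtain ⟨b, hb, e'⟩ := h' d hd c hc (by linarith [dist_nonneg (x := a) (y := d)])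
    exact ⟨b, hb, by linarith [dist_triangle a d b]⟩
  · exact Or.inl (not_lt.1 hlt)

theorem Indep.image {A B C : Set U} (h : Indep A B C) (φ : U ≃ᵢ U) :
    Indep (φ '' A) (φ '' B) (φ '' C) := by
  rintro _ ⟨a, ha, rfl⟩ _ ⟨c, hc, rfl⟩ hlt
  rw [φ.dist_eq] at hlt
  obtain ⟨b, hb, e⟩ := h a ha c hc hlt
  exact ⟨φ b, ⟨b, hb, rfl⟩, by simpa only [φ.dist_eq] using e⟩

/-- Stationarity: if `A`, `C` are independent over `B`, and so are their images under two
isometries that agree on `B`, then distances between `A` and `C` are preserved. -/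
theorem Indep.dist_eq_dist (hU : IsBoundedUrysohn U) {A B C : Set U} {φ ρ : U ≃ᵢ U}
    (h : Indep A B C) (h' : Indep (φ '' A) (φ '' B) (ρ '' C)) (hφ : ∀ b ∈ B, φ b = ρ b)
    {a c : U} (ha : a ∈ A) (hc : c ∈ C) : dist (φ a) (ρ c) = dist a c := by
  apply le_antisymm
  · by_cases hlt : dist a c < 1
    · obtain ⟨b, hb, e⟩ := h a ha c hc hlt
      have := dist_triangle (φ a) (φ b) (ρ c)
      rw [φ.dist_eq, hφ b hb, ρ.dist_eq] at this
      linarith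
    · linarith [hU.dist_le_one (φ a) (ρ c)]
  · by_cases hlt : dist (φ a) (ρ c) < 1
    · obtain ⟨_, ⟨b, hb, rfl⟩, e⟩ := h' _ ⟨a, ha, rfl⟩ _ ⟨c, hc, rfl⟩ hlt
      rw [φ.dist_eq, hφ b hb, ρ.dist_eq] at e
      linarith [dist_triangle a b c]
    · linarith [hU.dist_le_one a c]

/-- Every type over a finite set `B` has a realisation that is independent over `B` from a
given finite set `C`: its distance to `c` is the smaller one of `1` and the length of a shortest
path through `B`. -/
theorem IsBoundedUrysohn.exists_realisesType_indep (hU : IsBoundedUrysohn U) {B C : Set U}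
    (hB : B.Finite) (hC : C.Finite) (a : U) :
    ∃ b, RealisesType B a b ∧ Indep {b} B C := by
  have hr : ∀ z : U, ∃ r : ℝ, r ≤ 1 ∧ (∀ y ∈ B, r ≤ dist a y + dist y z) ∧
      (r = 1 ∨ ∃ y ∈ B, r = dist a y + dist y z) := by
    intro z
    rcases B.eq_empty_or_nonempty with rfl | hne
    · exact ⟨1, le_rfl, by simp, Or.inl rfl⟩
    · obtain ⟨y, hy, hmin⟩ := Set.exists_min_image B (fun y => dist a y + dist y z) hB hne
      rcases le_total (dist a y + dist y z) 1 with h | h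
      · exact ⟨_, h, hmin, Or.inr ⟨y, hy, rfl⟩⟩
      · exact ⟨1, le_rfl, fun w hw => h.trans (hmin w hw), Or.inl rfl⟩
  choose f hf1 hf2 hf3 using hr
  have hf0 : ∀ z, 0 ≤ f z := fun z => by
    rcases hf3 z with h | ⟨y, -, h⟩ <;> rw [h] <;> positivity
  obtain ⟨b, hb⟩ := hU.exists_dist_eq (hB.union hC) f (fun x _ => hf1 x)
    (fun x _ y _ => by
      rcases hf3 y with h | ⟨w, hw, h⟩
      · linarith [hf1 x, dist_nonneg (x := x) (y := y)]
      · linarith [hf2 x w hw, dist_triangle w y x, dist_comm x y])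
    (fun x _ y _ => by
      rcases hf3 y with h | ⟨w, hw, h⟩
      · linarith [hf0 x, hU.dist_le_one x y]
      rcases hf3 x with h' | ⟨w', hw', h'⟩
      · linarith [hf0 y, hU.dist_le_one x y]
      · linarith [dist_triangle x w' a, dist_triangle x a y, dist_triangle a w y,
          dist_comm x w', dist_comm w' a])
  refine ⟨b, fun x hx => ?_, indep_of_le ?_⟩
  · rw [hb x (Or.inl hx)]
    apply le_antisymm
    · simpa using hf2 x x hx
    · rcases hf3 x with h | ⟨w, hw, h⟩
      · rw [h]; exact hU.dist_le_one _ _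
      · rw [h]; exact dist_triangle _ _ _
  · rintro a' (rfl : a' = b) c hc
    rw [hb c (Or.inr hc)]
    rcases hf3 c with h | ⟨w, hw, h⟩
    · exact Or.inl h.ge
    · refine Or.inr ⟨w, hw, ?_⟩
      have : dist a' w ≤ dist a w := by
        rw [hb w (Or.inl hw)]; simpa using hf2 w w hw
      linarith

/-- Existence of independent copies: a finite set `A` can be moved over `B` to be independent
from `C`. -/
theorem IsBoundedUrysohn.exists_indep (hU : IsBoundedUrysohn U) {A B C : Set U}
    (hA : A.Finite) (hB : B.Finite) (hC : C.Finite) :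
    ∃ φ : U ≃ᵢ U, (∀ b ∈ B, φ b = b) ∧ Indep (φ '' A) B C := by
  induction A, hA using Set.Finite.induction_on with
  | empty => exact ⟨1, fun _ _ => rfl, by simp [Indep]⟩
  | @insert a A _ hA ih =>
    obtain ⟨φ, hφ, hi⟩ := ih
    have hfin : (B ∪ φ '' A).Finite := hB.union (hA.image _)
    obtain ⟨b, hb, hbi⟩ := hU.exists_realisesType_indep hfin hC (φ a)
    obtain ⟨ψ, hψ, rfl⟩ := (realisesType_iff hU hfin _ _).1 hb
    refine ⟨ψ * φ, fun x hx => ?_, ?_⟩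
    · change ψ (φ x) = x
      rw [hφ x hx, hψ x (Or.inl hx)]
    · have h1 : Indep (B ∪ φ '' A) B C := (indep_of_subset subset_rfl).union_left hi
      refine ((hbi.trans h1).union_left hi).mono ?_ subset_rfl
      rintro _ ⟨x, rfl | hx, rfl⟩
      · exact Or.inl rfl
      · exact Or.inr ⟨x, hx, (hψ _ (Or.inr ⟨x, hx, rfl⟩)).symm⟩

/-! ### Isometries that move almost maximally -/

theorem Indep.trans_right {A B C D : Set U} (h : Indep A D C) (h' : Indep A B D) :
    Indep A B C := (h.symm.trans h'.symm).symm

theorem image_eq_of_forall_fixed {φ : U ≃ᵢ U} {B : Set U} (h : ∀ b ∈ B, φ b = b) : φ '' B = B := by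
  rw [Set.image_congr h, Set.image_id']

theorem image_image_inv (φ : U ≃ᵢ U) (A : Set U) : φ '' ((φ⁻¹ : U ≃ᵢ U) '' A) = A := by
  rw [Set.image_image, Set.image_congr fun x _ => φ.apply_inv_self x, Set.image_id']

theorem inv_image_image (φ : U ≃ᵢ U) (A : Set U) : (φ⁻¹ : U ≃ᵢ U) '' (φ '' A) = A :=
  image_image_inv φ⁻¹ A

theorem inv_apply_eq_self {φ : U ≃ᵢ U} {x : U} (h : φ x = x) : φ⁻¹ x = x := by
  conv_lhs => rw [← h]
  exact φ.inv_apply_self x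

theorem conj_apply_of_fixed {φ u : U ≃ᵢ U} {x : U} (h : φ x = x) (h' : φ (u x) = u x) :
    (φ * u * φ⁻¹) x = u x := by
  change φ (u (φ⁻¹ x)) = u x
  rw [inv_apply_eq_self h, h']

theorem RealisesType.indep (hU : IsBoundedUrysohn U) {B C : Set U} (hB : B.Finite) (hC : C.Finite)
    {a b : U} (h : RealisesType (B ∪ C) a b) (ha : Indep {a} B C) : Indep {b} B C := by
  obtain ⟨ψ, hψ, rfl⟩ := (realisesType_iff hU (hB.union hC) _ _).1 h
  have := ha.image ψ
  rwa [image_eq_of_forall_fixed fun b hb => hψ b (Or.inl hb),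
    image_eq_of_forall_fixed fun b hb => hψ b (Or.inr hb), Set.image_singleton] at this

/-- The realisation in the definition of moving almost maximally may be taken independent over
`X` from any given finite set. -/
theorem MovesAlmostMaximally.exists_indep (hU : IsBoundedUrysohn U) {g : U ≃ᵢ U}
    (hg : MovesAlmostMaximally g) {X C : Set U} (hX : X.Finite) (hC : C.Finite) (a : U) :
    ∃ b, RealisesType X a b ∧ Indep {b} X C ∧ Indep {b} X {g b} := by
  obtain ⟨a', ha', hi⟩ := hU.exists_realisesType_indep hX hC a
  obtain ⟨b, hb, hgb⟩ := hg (X ∪ C) (hX.union hC) a'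
  have hbi := hb.indep hU hX hC hi
  exact ⟨b, fun x hx => (hb x (Or.inl hx)).trans (ha' x hx), hbi,
    hgb.trans_right ((indep_of_subset subset_rfl).symm.union_right hbi)⟩

theorem MovesAlmostMaximally.inv (hU : IsBoundedUrysohn U) {g : U ≃ᵢ U}
    (hg : MovesAlmostMaximally g) : MovesAlmostMaximally g⁻¹ := by
  intro X hX a
  obtain ⟨b, hb, hi, hgb⟩ := hg.exists_indep hU hX (hX.image (g⁻¹ : U ≃ᵢ U)) a
  refine ⟨b, hb, ?_⟩
  have h1 := hi.image g
  rw [Set.image_singleton, image_image_inv] at h1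
  have h3 := (hgb.symm.trans_right h1).image (g⁻¹ : U ≃ᵢ U)
  rw [Set.image_singleton, Set.image_singleton, inv_image_image, g.inv_apply_self] at h3
  exact h3

theorem MovesAlmostMaximally.conj {g : U ≃ᵢ U} (hg : MovesAlmostMaximally g) (φ : U ≃ᵢ U) :
    MovesAlmostMaximally (φ * g * φ⁻¹) := by
  intro X hX a
  obtain ⟨b, hb, hi⟩ := hg ((φ⁻¹ : U ≃ᵢ U) '' X) (hX.image _) (φ⁻¹ a)
  refine ⟨φ b, fun x hx => ?_, ?_⟩
  · have := hb _ ⟨x, hx, rfl⟩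
    rw [(φ⁻¹ : U ≃ᵢ U).dist_eq] at this
    rw [← this, ← φ.dist_eq b, φ.apply_inv_self]
  · have h := hi.image φ
    rw [Set.image_singleton, Set.image_singleton, image_image_inv] at h
    have e : (φ * g * φ⁻¹) (φ b) = φ (g b) := congrArg (φ * g) (φ.inv_apply_self b)
    rwa [e]

/-- Moving almost maximally passes from single points to finite sets: over a finite `X`, any
finite set `A` has a copy that is independent over `X` from its image, and also from the images
of `X` under `g` and `g⁻¹`. -/
theorem MovesAlmostMaximally.exists_indep_image (hU : IsBoundedUrysohn U) {g : U ≃ᵢ U}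
    (hg : MovesAlmostMaximally g) {X A : Set U} (hX : X.Finite) (hA : A.Finite) :
    ∃ φ : U ≃ᵢ U, (∀ x ∈ X, φ x = x) ∧ Indep (φ '' A) X (g '' X) ∧
      Indep (φ '' A) X ((g⁻¹ : U ≃ᵢ U) '' X) ∧ Indep (φ '' A) X (g '' (φ '' A)) := by
  induction A, hA using Set.Finite.induction_on with
  | empty => exact ⟨1, fun _ _ => rfl, by simp [Indep], by simp [Indep], by simp [Indep]⟩
  | @insert a A _ hA ih =>
    obtain ⟨φ, hφ, h1, h2, h3⟩ := ih
    set D := φ '' A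
    have hV : (X ∪ D).Finite := hX.union (hA.image _)
    obtain ⟨b, hb, hbi, hgb⟩ := hg.exists_indep hU hV
      ((hV.image g).union (hV.image (g⁻¹ : U ≃ᵢ U))) (φ a)
    obtain ⟨ψ, hψ, rfl⟩ := (realisesType_iff hU hV _ _).1 hb
    set b := ψ (φ a)
    have hXX : ∀ C : Set U, Indep X X C := fun C => indep_of_subset subset_rfl
    have hb1 : Indep {b} (X ∪ D) (g '' (X ∪ D)) := hbi.mono subset_rfl Set.subset_union_left
    have hb2 : Indep {b} (X ∪ D) ((g⁻¹ : U ≃ᵢ U) '' (X ∪ D)) :=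
      hbi.mono subset_rfl Set.subset_union_right
    rw [Set.image_union] at hb1
    have hbX : Indep {b} X (g '' X) :=
      (hb1.mono subset_rfl Set.subset_union_left).trans ((hXX _).union_left h1)
    have hbX' : Indep {b} X ((g⁻¹ : U ≃ᵢ U) '' X) :=
      (hb2.mono subset_rfl (Set.image_mono Set.subset_union_left)).trans
        ((hXX _).union_left h2)
    have hbD : Indep {b} X (g '' D) :=
      (hb1.mono subset_rfl Set.subset_union_right).trans ((hXX _).union_left h3)
    have hDb : Indep D X {g b} := by
      have h := (hb2.mono subset_rfl (Set.image_mono Set.subset_union_right)).image g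
      rw [Set.image_singleton, image_image_inv, Set.image_union] at h
      exact (h.trans (h1.symm.union_left h3.symm)).symm
    have hbb : Indep {b} X {g b} := hgb.trans ((hXX _).union_left hDb)
    have himg : (ψ * φ : U ≃ᵢ U) '' (insert a A) = {b} ∪ D := by
      rw [Set.image_insert_eq, Set.singleton_union]
      congr 1
      change (fun x => ψ (φ x)) '' A = φ '' A
      exact Set.image_congr fun x hx => hψ _ (Or.inr ⟨x, hx, rfl⟩)
    refine ⟨ψ * φ, fun x hx => ?_, ?_, ?_, ?_⟩
    · change ψ (φ x) = x
      rw [hφ x hx, hψ x (Or.inl hx)]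
    · rw [himg]
      exact hbX.union_left h1
    · rw [himg]
      exact hbX'.union_left h2
    · rw [himg, Set.image_union, Set.image_singleton]
      exact (hbb.union_right hbD).union_left (hDb.union_right h3)

/-- After conjugating `u` by an isometry fixing `X` and `Y = u X`, the image of a finite set
`X' ⊇ X` is independent over `Y` from `Z`, provided that `X` is. -/
theorem MovesAlmostMaximally.exists_conj_indep (hU : IsBoundedUrysohn U) {u : U ≃ᵢ U}
    (hu : MovesAlmostMaximally u) {X X' Y Z : Set U} (hX' : X'.Finite) (hZ : Z.Finite)
    (hXX' : X ⊆ X') (hY : u '' X = Y) (hi : Indep X Y Z) :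
    ∃ φ : U ≃ᵢ U, (∀ x ∈ X ∪ Y, φ x = x) ∧ Indep ((φ * u * φ⁻¹ : U ≃ᵢ U) '' X') Y Z := by
  have hX : X.Finite := hX'.subset hXX'
  have hB : (X ∪ Y).Finite := hX.union (hY ▸ hX.image _)
  obtain ⟨φ, hφ, -, -, h3⟩ := hu.exists_indep_image hU hB hX'
  have hφ' : ∀ x ∈ X ∪ Y, φ⁻¹ x = x := fun x hx => inv_apply_eq_self (hφ x hx)
  obtain ⟨ψ, hψ, h4⟩ := hU.exists_indep ((hX'.image φ).image u |>.image (φ⁻¹ : U ≃ᵢ U))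
    (hB.union hX') hZ
  have hψB : ∀ x ∈ X ∪ Y, ψ x = x := fun x hx => hψ x (Or.inl hx)
  have hψX : ∀ x ∈ X', ψ x = x := fun x hx => hψ x (Or.inr hx)
  have h5 := (h3.image (φ⁻¹ : U ≃ᵢ U)).image ψ
  rw [inv_image_image, image_eq_of_forall_fixed hφ', image_eq_of_forall_fixed hψB,
    image_eq_of_forall_fixed hψX] at h5
  have himg : ((ψ * φ⁻¹) * u * (ψ * φ⁻¹)⁻¹ : U ≃ᵢ U) '' X' =
      ψ '' ((φ⁻¹ : U ≃ᵢ U) '' (u '' (φ '' X'))) := by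
    simp only [Set.image_image]
    refine Set.image_congr fun x hx => ?_
    have : (ψ * φ⁻¹)⁻¹ = φ * ψ⁻¹ := by group
    rw [this]
    change ψ (φ⁻¹ (u (φ (ψ⁻¹ x)))) = _
    rw [inv_apply_eq_self (hψX x hx)]
  refine ⟨ψ * φ⁻¹, fun x hx => ?_, ?_⟩
  · change ψ (φ⁻¹ x) = x
    rw [hφ' x hx, hψB x hx]
  · rw [himg]
    have h6 := h4.trans_right ((indep_of_subset (subset_rfl)).symm.union_right h5.symm)
    exact h6.trans (hi.union_left (indep_of_subset subset_rfl))

/-- If `X'` is independent from `Y = u X` over `X`, then `u` has a conjugate by an isometry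
fixing `X` and `Y` that agrees on `X'` with any prescribed isometry `σ` extending `u` on `X` for
which `σ X'` is independent from `X'` over `Y`. By stationarity the pair `X', σ X'` has the type
over `X ∪ Y` of the pair `A, u A`, for a copy `A` of `X'` moved maximally by `u`. -/
theorem MovesAlmostMaximally.exists_conj_eqOn (hU : IsBoundedUrysohn U) {u : U ≃ᵢ U}
    (hu : MovesAlmostMaximally u) {X X' Y : Set U} (hX' : X'.Finite)
    (hXX' : X ⊆ X') (hY : u '' X = Y) (hi : Indep X' X Y) (σ : U ≃ᵢ U) (hσ : ∀ x ∈ X, σ x = u x)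
    (hσi : Indep (σ '' X') Y X') :
    ∃ φ : U ≃ᵢ U, (∀ x ∈ X ∪ Y, φ x = x) ∧ ∀ x ∈ X', (φ * u * φ⁻¹) x = σ x := by
  have hX : X.Finite := hX'.subset hXX'
  have hYf : Y.Finite := hY ▸ hX.image _
  obtain ⟨φ₀, hφ₀, h1, h2, h3⟩ := hu.exists_indep_image hU hX hX'
  have hφ₀' : ∀ x ∈ X, φ₀⁻¹ x = x := fun x hx => inv_apply_eq_self (hφ₀ x hx)
  set A := φ₀ '' X' with hA
  have hAf : A.Finite := hX'.image _
  have hXA : X ⊆ A := fun x hx => ⟨x, hXX' hx, hφ₀ x hx⟩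
  have hAX' : (φ₀⁻¹ : U ≃ᵢ U) '' A = X' := inv_image_image φ₀ X'
  rw [hY] at h1
  -- `φ₁` carries `A` back to `X'` and fixes `Y`.
  obtain ⟨φ₁, hφ₁A, hφ₁Y⟩ := hU.exists_glue hAf hYf φ₀⁻¹ 1 fun a ha c hc =>
    h1.dist_eq_dist hU (φ := φ₀⁻¹) (ρ := 1) (by
      rw [hAX', image_eq_of_forall_fixed hφ₀', image_eq_of_forall_fixed fun _ _ => rfl]
      exact hi) hφ₀' ha hc
  have hφ₁X : ∀ x ∈ X, φ₁ x = x := fun x hx => by rw [hφ₁A x (hXA hx), hφ₀' x hx]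
  have hφ₁Y' : ∀ y ∈ Y, φ₁ y = y := fun y hy => hφ₁Y y hy
  have hφ₁A' : φ₁ '' A = X' := by rw [Set.image_congr hφ₁A, hAX']
  have huA : Indep (u '' A) Y A := by
    have h := h2.image u
    rw [hY, image_image_inv] at h
    exact h3.symm.trans_right h
  have hYY : ∀ C : Set U, Indep C Y Y := fun C => (indep_of_subset subset_rfl).symm
  let ψ : U ≃ᵢ U := σ * φ₀⁻¹ * u⁻¹
  have hψu : ∀ x, ψ (u x) = σ (φ₀⁻¹ x) := fun x =>
    congrArg (fun z => σ (φ₀⁻¹ z)) (u.inv_apply_self x)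
  have hψA : ψ '' (u '' A) = σ '' X' := by
    rw [← hAX', Set.image_image σ, Set.image_image ψ]
    exact Set.image_congr fun x _ => hψu x
  have hψY : ∀ y ∈ Y, ψ y = y := by
    rw [← hY]
    rintro _ ⟨x, hx, rfl⟩
    rw [hψu, hφ₀' x hx, hσ x hx]
  obtain ⟨φ, hφu, hφ⟩ := hU.exists_glue (hAf.image u) (hAf.union hYf) ψ φ₁ fun a ha c hc =>
    (huA.union_right (hYY _)).dist_eq_dist hU (φ := ψ) (ρ := φ₁) (by
      rw [hψA, image_eq_of_forall_fixed hψY, Set.image_union, hφ₁A',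
        image_eq_of_forall_fixed hφ₁Y']
      exact hσi.union_right (hYY _)) (fun y hy => by rw [hψY y hy, hφ₁Y' y hy]) ha hc
  refine ⟨φ, ?_, fun x hx => ?_⟩
  · rintro x (hx | hx)
    · rw [hφ x (Or.inl (hXA hx)), hφ₁X x hx]
    · rw [hφ x (Or.inr hx), hφ₁Y' x hx]
  · have hxA : φ₀ x ∈ A := ⟨x, hx, rfl⟩
    have e : φ (φ₀ x) = x := by
      rw [hφ _ (Or.inl hxA), hφ₁A _ hxA, φ₀.inv_apply_self]
    have e' : φ⁻¹ x = φ₀ x := by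
      conv_lhs => rw [← e]
      exact φ.inv_apply_self _
    change φ (u (φ⁻¹ x)) = σ x
    rw [e', hφu _ ⟨_, hxA, rfl⟩, hψu, φ₀.inv_apply_self]

/-! ### Products of four conjugates with prescribed values on a finite set -/

/-- Let `u₁, …, u₄` move almost maximally, let `X₀ = E, X₁, …, X₄` be the successive images of `E`
and suppose that `X₀, X₂` are independent over `X₁` and `X₄, X₂` are independent over `X₃`. Then
any isometry `s` which agrees with the product on `E` can be matched on any finite set
`E' ⊇ E`, after conjugating each `uᵢ` by an isometry that fixes `Xᵢ₋₁ ∪ Xᵢ`.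

Let `P₁` be the image of `E'` under `u₁` and `P₃` that of `s E'` under `u₄⁻¹`. By conjugating `u₁`
and `u₄` these are made independent from `X₂` over `X₁` and `X₃`. A copy of `E'` over `X₂` that is
independent from both `P₁` and `P₃` can then be the image of `P₁` under a conjugate of `u₂` and
that of `P₃` under a conjugate of `u₃⁻¹`. -/
theorem IsBoundedUrysohn.exists_four_conj (hU : IsBoundedUrysohn U) {u₁ u₂ u₃ u₄ : U ≃ᵢ U}
    (h₁ : MovesAlmostMaximally u₁) (h₂ : MovesAlmostMaximally u₂) (h₃ : MovesAlmostMaximally u₃)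
    (h₄ : MovesAlmostMaximally u₄) {E E' X₁ X₂ X₃ X₄ : Set U} (hX₁ : u₁ '' E = X₁)
    (hX₂ : u₂ '' X₁ = X₂) (hX₃ : u₃ '' X₂ = X₃) (hX₄ : u₄ '' X₃ = X₄) (hE' : E'.Finite)
    (hEE' : E ⊆ E') (hi : Indep E X₁ X₂) (hi' : Indep X₄ X₃ X₂) (s : U ≃ᵢ U)
    (hs : ∀ x ∈ E, u₄ (u₃ (u₂ (u₁ x))) = s x) :
    ∃ φ₁ φ₂ φ₃ φ₄ : U ≃ᵢ U, (∀ x ∈ E ∪ X₁, φ₁ x = x) ∧ (∀ x ∈ X₁ ∪ X₂, φ₂ x = x) ∧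
      (∀ x ∈ X₂ ∪ X₃, φ₃ x = x) ∧ (∀ x ∈ X₃ ∪ X₄, φ₄ x = x) ∧
      ∀ x ∈ E', (φ₄ * u₄ * φ₄⁻¹) ((φ₃ * u₃ * φ₃⁻¹) ((φ₂ * u₂ * φ₂⁻¹) ((φ₁ * u₁ * φ₁⁻¹) x))) =
        s x := by
  have hE : E.Finite := hE'.subset hEE'
  have hX₁f : X₁.Finite := hX₁ ▸ hE.image _
  have hX₂f : X₂.Finite := hX₂ ▸ hX₁f.image _
  have hsE : s '' E = X₄ := by
    rw [← hX₄, ← hX₃, ← hX₂, ← hX₁, Set.image_image, Set.image_image, Set.image_image]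
    exact Set.image_congr fun x hx => (hs x hx).symm
  obtain ⟨φ₁, hφ₁, hP₁⟩ := h₁.exists_conj_indep hU hE' hX₂f hEE' hX₁ hi
  obtain ⟨φ₄, hφ₄, hP₃⟩ := (h₄.inv hU).exists_conj_indep hU (X := X₄) (X' := s '' E') (Y := X₃)
    (hE'.image s) hX₂f (by rw [← hsE]; exact Set.image_mono hEE')
    (by rw [← hX₄, inv_image_image]) hi'
  set w₁ : U ≃ᵢ U := φ₁ * u₁ * φ₁⁻¹ with hw₁
  set w₄ : U ≃ᵢ U := φ₄ * u₄ * φ₄⁻¹ with hw₄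
  have hw₄' : φ₄ * u₄⁻¹ * φ₄⁻¹ = w₄⁻¹ := by rw [hw₄]; group
  rw [hw₄'] at hP₃
  set P₁ := w₁ '' E' with hP₁d
  set P₃ := (w₄⁻¹ : U ≃ᵢ U) '' (s '' E') with hP₃d
  have hP₁f : P₁.Finite := hE'.image _
  have hP₃f : P₃.Finite := (hE'.image _).image _
  have hu₁ : ∀ x ∈ E, u₁ x ∈ X₁ := fun x hx => hX₁ ▸ ⟨x, hx, rfl⟩
  have hu₂ : ∀ x ∈ X₁, u₂ x ∈ X₂ := fun x hx => hX₂ ▸ ⟨x, hx, rfl⟩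
  have hu₃ : ∀ x ∈ X₂, u₃ x ∈ X₃ := fun x hx => hX₃ ▸ ⟨x, hx, rfl⟩
  have hu₄ : ∀ x ∈ X₃, u₄ x ∈ X₄ := fun x hx => hX₄ ▸ ⟨x, hx, rfl⟩
  have hw₁E : ∀ x ∈ E, w₁ x = u₁ x := fun x hx =>
    conj_apply_of_fixed (hφ₁ x (Or.inl hx)) (hφ₁ _ (Or.inr (hu₁ x hx)))
  have hw₄X : ∀ x ∈ X₃, w₄ x = u₄ x := fun x hx =>
    conj_apply_of_fixed (hφ₄ x (Or.inr hx)) (hφ₄ _ (Or.inl (hu₄ x hx)))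
  have hX₁P₁ : X₁ ⊆ P₁ := by
    rw [← hX₁]
    rintro _ ⟨x, hx, rfl⟩
    exact ⟨x, hEE' hx, hw₁E x hx⟩
  -- `w₄` agrees with `u₄` on `X₃`, so the product still has the values of `s` on `E`.
  have hback : ∀ x ∈ E, w₄ (u₃ (u₂ (u₁ x))) = s x := fun x hx => by
    rw [hw₄X _ (hu₃ _ (hu₂ _ (hu₁ x hx))), hs x hx]
  have hX₃P₃ : X₃ ⊆ P₃ := by
    rw [← hX₃, ← hX₂, ← hX₁]
    rintro _ ⟨_, ⟨_, ⟨x, hx, rfl⟩, rfl⟩, rfl⟩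
    refine ⟨s x, ⟨x, hEE' hx, rfl⟩, ?_⟩
    rw [← hback x hx, w₄.inv_apply_self]
  obtain ⟨ρ, hρ, hρi⟩ := hU.exists_indep (hP₁f.image u₂) hX₂f (hP₁f.union hP₃f)
  have hσ₂ : ∀ x ∈ X₁, (ρ * u₂) x = u₂ x := fun x hx => hρ _ (hu₂ x hx)
  have himg₂ : (ρ * u₂ : U ≃ᵢ U) '' P₁ = ρ '' (u₂ '' P₁) := by
    rw [Set.image_image ρ]; rfl
  obtain ⟨φ₂, hφ₂, hw₂⟩ := h₂.exists_conj_eqOn hU hP₁f hX₁P₁ hX₂ hP₁ (ρ * u₂) hσ₂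
    (by rw [himg₂]; exact hρi.mono subset_rfl Set.subset_union_left)
  let σ₃ : U ≃ᵢ U := ρ * u₂ * w₁ * s⁻¹ * w₄
  have hσ₃ : ∀ x, σ₃ (w₄⁻¹ (s x)) = ρ (u₂ (w₁ x)) := fun x => by
    change ρ (u₂ (w₁ (s⁻¹ (w₄ (w₄⁻¹ (s x)))))) = _
    rw [w₄.apply_inv_self, s.inv_apply_self]
  have hσ₃X : ∀ x ∈ X₃, σ₃ x = u₃⁻¹ x := by
    rw [← hX₃, ← hX₂, ← hX₁]
    rintro _ ⟨_, ⟨_, ⟨x, hx, rfl⟩, rfl⟩, rfl⟩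
    have h := hσ₃ x
    rw [← hback x hx, w₄.inv_apply_self, hw₁E x hx, hρ _ (hu₂ _ (hu₁ x hx))] at h
    rw [h, u₃.inv_apply_self]
  have himg₃ : σ₃ '' P₃ = ρ '' (u₂ '' P₁) := by
    simp only [hP₃d, hP₁d, Set.image_image]
    exact Set.image_congr fun x _ => hσ₃ x
  obtain ⟨φ₃, hφ₃, hw₃⟩ := (h₃.inv hU).exists_conj_eqOn hU (Y := X₂) hP₃f hX₃P₃
    (by rw [← hX₃, inv_image_image]) hP₃ σ₃ hσ₃X
    (by rw [himg₃]; exact hρi.mono subset_rfl Set.subset_union_right)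
  refine ⟨φ₁, φ₂, φ₃, φ₄, hφ₁, hφ₂, fun x hx => hφ₃ x hx.symm, fun x hx => hφ₄ x hx.symm,
    fun x hx => ?_⟩
  rw [hw₂ _ ⟨x, hx, rfl⟩]
  have h3 := hw₃ _ ⟨s x, ⟨x, hx, rfl⟩, rfl⟩
  rw [hσ₃] at h3
  have e : φ₃ * u₃⁻¹ * φ₃⁻¹ = (φ₃ * u₃ * φ₃⁻¹)⁻¹ := by group
  rw [e] at h3
  change w₄ ((φ₃ * u₃ * φ₃⁻¹) (ρ (u₂ (w₁ x)))) = s x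
  rw [← h3, (φ₃ * u₃ * φ₃⁻¹).apply_inv_self, w₄.apply_inv_self]

/-- The products of the first `i` of the conjugates `(κ j)⁻¹ * h * κ j` of `h`. Only indices below
`4` are relevant in the sequel. -/
def conjWalk (h : U ≃ᵢ U) (κ : ℕ → (U ≃ᵢ U)) : ℕ → (U ≃ᵢ U)
  | 0 => 1
  | i + 1 => (κ i)⁻¹ * h * κ i * conjWalk h κ i

/-- `κ'` agrees with `κ` wherever this matters for the walk of a point of `E`. -/
def WalkExtends (h : U ≃ᵢ U) (κ κ' : ℕ → (U ≃ᵢ U)) (E : Set U) : Prop :=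
  ∀ i < 4, ∀ x ∈ conjWalk h κ i '' E ∪ conjWalk h κ (i + 1) '' E, κ' i x = κ i x

/-- The independence that permits to prescribe the product of the four conjugates at further
points. -/
def WalkGood (h : U ≃ᵢ U) (κ : ℕ → (U ≃ᵢ U)) (E : Set U) : Prop :=
  Indep E (conjWalk h κ 1 '' E) (conjWalk h κ 2 '' E) ∧
    Indep (conjWalk h κ 4 '' E) (conjWalk h κ 3 '' E) (conjWalk h κ 2 '' E)

/-- `F` is contained in all sets that the walk of `E` passes, and in their images under `κ`. -/
def WalkCovers (h : U ≃ᵢ U) (κ : ℕ → (U ≃ᵢ U)) (E F : Set U) : Prop :=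
  ∀ i < 4, F ⊆ conjWalk h κ i '' E ∧ F ⊆ κ i '' (conjWalk h κ i '' E)

theorem WalkExtends.mono {h : U ≃ᵢ U} {κ κ' : ℕ → (U ≃ᵢ U)} {E E' : Set U}
    (H : WalkExtends h κ κ' E') (hE : E ⊆ E') : WalkExtends h κ κ' E := fun i hi x hx =>
  H i hi x (Set.union_subset_union (Set.image_mono hE) (Set.image_mono hE) hx)

theorem WalkExtends.conjWalk_apply {h : U ≃ᵢ U} {κ κ' : ℕ → (U ≃ᵢ U)} {E : Set U}
    (H : WalkExtends h κ κ' E) {i : ℕ} (hi : i ≤ 4) {x : U} (hx : x ∈ E) :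
    conjWalk h κ' i x = conjWalk h κ i x := by
  induction i with
  | zero => rfl
  | succ i ih =>
    have h1 := H i hi _ (Or.inl ⟨x, hx, rfl⟩)
    have h2 := H i hi _ (Or.inr ⟨x, hx, rfl⟩)
    change (κ' i)⁻¹ (h (κ' i (conjWalk h κ' i x))) = _
    have e : κ i (conjWalk h κ (i + 1) x) = h (κ i (conjWalk h κ i x)) :=
      (κ i).apply_inv_self _
    rw [ih (by omega), h1, ← e, ← h2, (κ' i).inv_apply_self]

theorem WalkExtends.image_eq {h : U ≃ᵢ U} {κ κ' : ℕ → (U ≃ᵢ U)} {E : Set U}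
    (H : WalkExtends h κ κ' E) {i : ℕ} (hi : i ≤ 4) :
    conjWalk h κ' i '' E = conjWalk h κ i '' E :=
  Set.image_congr fun _ hx => H.conjWalk_apply hi hx

theorem WalkExtends.image_subset {h : U ≃ᵢ U} {κ κ' : ℕ → (U ≃ᵢ U)} {E E' : Set U}
    (H : WalkExtends h κ κ' E) (hE : E ⊆ E') {i : ℕ} (hi : i ≤ 4) :
    conjWalk h κ i '' E ⊆ conjWalk h κ' i '' E' := by
  rw [← H.image_eq hi]
  exact Set.image_mono hE

theorem WalkExtends.trans {h : U ≃ᵢ U} {κ κ' κ'' : ℕ → (U ≃ᵢ U)} {E E' : Set U}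
    (H : WalkExtends h κ κ' E) (hE : E ⊆ E') (H' : WalkExtends h κ' κ'' E') :
    WalkExtends h κ κ'' E := fun i hi x hx => by
  rw [← H i hi x hx]
  exact H' i hi x (Set.union_subset_union (H.image_subset hE (by omega))
    (H.image_subset hE (by omega)) hx)

theorem WalkCovers.extends {h : U ≃ᵢ U} {κ κ' : ℕ → (U ≃ᵢ U)} {E E' F : Set U}
    (hF : WalkCovers h κ E F) (H : WalkExtends h κ κ' E) (hE : E ⊆ E') :
    WalkCovers h κ' E' F := by
  intro i hi
  have hs := H.image_subset hE (i := i) (by omega)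
  refine ⟨(hF i hi).1.trans hs, (hF i hi).2.trans ?_⟩
  rintro _ ⟨x, hx, rfl⟩
  exact ⟨x, hs hx, H i hi x (Or.inl hx)⟩

theorem conjWalk_succ_image (h : U ≃ᵢ U) (κ : ℕ → (U ≃ᵢ U)) (i : ℕ) (E : Set U) :
    conjWalk h κ (i + 1) '' E = ((κ i)⁻¹ * h * κ i : U ≃ᵢ U) '' (conjWalk h κ i '' E) := by
  rw [Set.image_image]
  rfl

theorem conjWalk_zero_image (h : U ≃ᵢ U) (κ : ℕ → (U ≃ᵢ U)) (E : Set U) :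
    conjWalk h κ 0 '' E = E := Set.image_id E

theorem WalkGood.exists_extends (hU : IsBoundedUrysohn U) {h : U ≃ᵢ U}
    (hh : MovesAlmostMaximally h) {κ : ℕ → (U ≃ᵢ U)} {E E' : Set U} (hE' : E'.Finite)
    (hEE' : E ⊆ E') (hG : WalkGood h κ E) (s : U ≃ᵢ U) (hs : ∀ x ∈ E, conjWalk h κ 4 x = s x) :
    ∃ κ', WalkExtends h κ κ' E ∧ ∀ x ∈ E', conjWalk h κ' 4 x = s x := by
  have hu : ∀ i, MovesAlmostMaximally ((κ i)⁻¹ * h * κ i) := fun i => by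
    simpa using hh.conj (κ i)⁻¹
  obtain ⟨φ₁, φ₂, φ₃, φ₄, h1, h2, h3, h4, H⟩ := hU.exists_four_conj (hu 0) (hu 1) (hu 2) (hu 3)
    (by rw [conjWalk_succ_image, conjWalk_zero_image]) (conjWalk_succ_image h κ 1 E).symm
    (conjWalk_succ_image h κ 2 E).symm (conjWalk_succ_image h κ 3 E).symm hE' hEE' hG.1 hG.2 s hs
  let φ : ℕ → (U ≃ᵢ U) := fun
    | 0 => φ₁
    | 1 => φ₂
    | 2 => φ₃
    | _ => φ₄
  have hconj : ∀ i, (κ i * (φ i)⁻¹)⁻¹ * h * (κ i * (φ i)⁻¹) =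
      φ i * ((κ i)⁻¹ * h * κ i) * (φ i)⁻¹ := fun i => by group
  have hfix : ∀ i < 4, ∀ x ∈ conjWalk h κ i '' E ∪ conjWalk h κ (i + 1) '' E, φ i x = x := by
    intro i hi
    interval_cases i
    · rw [conjWalk_zero_image]; exact h1
    · exact h2
    · exact h3
    · exact h4
  refine ⟨fun i => κ i * (φ i)⁻¹, fun i hi x hx => ?_, fun x hx => ?_⟩
  · change κ i ((φ i)⁻¹ x) = κ i x
    rw [inv_apply_eq_self (hfix i hi x hx)]
  · rw [← H x hx]
    simp only [conjWalk, hconj]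
    rfl

/-- Any finite walk extends to a good one: `X₁` and `X₃` are enlarged so as to contain the old
`X₀` and `X₄`, and the new parts of `X₀ = u₁⁻¹ X₁` and `X₄ = u₄ X₃` are moved away from `X₂`. -/
theorem exists_walkGood (hU : IsBoundedUrysohn U) (h : U ≃ᵢ U) (κ : ℕ → (U ≃ᵢ U)) {E : Set U}
    (hE : E.Finite) :
    ∃ κ' E', E ⊆ E' ∧ E'.Finite ∧ WalkExtends h κ κ' E ∧ WalkGood h κ' E' := by
  let u : ℕ → (U ≃ᵢ U) := fun i => (κ i)⁻¹ * h * κ i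
  let H : ℕ → Set U := fun i => conjWalk h κ i '' E
  have hH : ∀ i, H (i + 1) = u i '' H i := fun i => conjWalk_succ_image h κ i E
  have hH0 : H 0 = E := conjWalk_zero_image h κ E
  have hHf : ∀ i, (H i).Finite := fun i => hE.image _
  let X₂ : Set U := H 2 ∪ u 1 '' H 0 ∪ ((u 2)⁻¹ : U ≃ᵢ U) '' H 4
  have hX₂f : X₂.Finite := ((hHf 2).union ((hHf 0).image _)).union ((hHf 4).image _)
  let X₁ : Set U := ((u 1)⁻¹ : U ≃ᵢ U) '' X₂
  let X₃ : Set U := u 2 '' X₂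
  have hX₁f : X₁.Finite := hX₂f.image _
  have hX₃f : X₃.Finite := hX₂f.image _
  have h01 : H 0 ∪ H 1 ⊆ X₁ := by
    rw [Set.union_subset_iff, ← inv_image_image (u 1) (H 0), ← inv_image_image (u 1) (H 1), ← hH]
    exact ⟨Set.image_mono fun x hx => Or.inl (Or.inr hx),
      Set.image_mono fun x hx => Or.inl (Or.inl hx)⟩
  have h34 : H 3 ∪ H 4 ⊆ X₃ := by
    rw [Set.union_subset_iff, hH 2, ← image_image_inv (u 2) (H 4)]
    exact ⟨Set.image_mono fun x hx => Or.inl (Or.inl hx),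
      Set.image_mono fun x hx => Or.inr hx⟩
  obtain ⟨φ₁, hφ₁, hi₁⟩ := hU.exists_indep (hX₁f.image ((u 0)⁻¹ : U ≃ᵢ U)) hX₁f hX₂f
  obtain ⟨φ₄, hφ₄, hi₄⟩ := hU.exists_indep (hX₃f.image (u 3)) hX₃f hX₂f
  let φ : ℕ → (U ≃ᵢ U) := fun
    | 0 => φ₁
    | 1 => 1
    | 2 => 1
    | _ => φ₄
  let κ' : ℕ → (U ≃ᵢ U) := fun i => κ i * (φ i)⁻¹
  let E' : Set U := φ₁ '' (((u 0)⁻¹ : U ≃ᵢ U) '' X₁)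
  have hconj : ∀ i, (κ' i)⁻¹ * h * κ' i = φ i * u i * (φ i)⁻¹ := fun i => by
    simp only [κ', u]
    group
  have hW1 : conjWalk h κ' 1 '' E' = X₁ := by
    rw [conjWalk_succ_image, conjWalk_zero_image, hconj, Set.image_image, Set.image_image]
    refine (Set.image_congr fun x hx => ?_).trans (Set.image_id X₁)
    change φ₁ (u 0 (φ₁⁻¹ (φ₁ ((u 0)⁻¹ x)))) = x
    rw [φ₁.inv_apply_self, (u 0).apply_inv_self, hφ₁ x hx]
  have hW2 : conjWalk h κ' 2 '' E' = X₂ := by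
    rw [conjWalk_succ_image, hW1, hconj]
    exact image_image_inv (u 1) X₂
  have hW3 : conjWalk h κ' 3 '' E' = X₃ := by
    rw [conjWalk_succ_image, hW2, hconj]
    rfl
  have hW4 : conjWalk h κ' 4 '' E' = φ₄ '' (u 3 '' X₃) := by
    rw [conjWalk_succ_image, hW3, hconj, Set.image_image φ₄]
    refine Set.image_congr fun x hx => ?_
    change φ₄ (u 3 (φ₄⁻¹ x)) = _
    rw [inv_apply_eq_self (hφ₄ x hx)]
  refine ⟨κ', E', fun x hx => ?_, (hX₁f.image _).image _, fun i hi x hx => ?_, ?_, ?_⟩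
  · have hx0 : x ∈ H 0 := hH0.symm ▸ hx
    refine ⟨x, ⟨u 0 x, h01 (Or.inr ?_), (u 0).inv_apply_self x⟩, hφ₁ x (h01 (Or.inl hx0))⟩
    rw [hH]
    exact ⟨x, hx0, rfl⟩
  · have hfix : φ i x = x := by
      interval_cases i
      · exact hφ₁ x (h01 hx)
      · rfl
      · rfl
      · exact hφ₄ x (h34 hx)
    change κ i ((φ i)⁻¹ x) = κ i x
    rw [inv_apply_eq_self hfix]
  · rw [hW1, hW2]
    exact hi₁
  · rw [hW2, hW3, hW4]
    exact hi₄

/-! ### Limits of isometries frozen on growing finite sets -/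

/-- Isometries `κ n` that agree from stage `n` on along the growing sets `A n` converge to an
isometry, if the union of the sets `A n` and the union of their images are dense. -/
theorem exists_limit_isometryEquiv [CompleteSpace U] {κ : ℕ → (U ≃ᵢ U)} {A : ℕ → Set U}
    (hA : Monotone A) (hκ : ∀ n, ∀ x ∈ A n, κ (n + 1) x = κ n x) (hd : Dense (⋃ n, A n))
    (hd' : Dense (⋃ n, κ n '' A n)) : ∃ K : U ≃ᵢ U, ∀ n, ∀ x ∈ A n, K x = κ n x := by
  have hκ' : ∀ n m, n ≤ m → ∀ x ∈ A n, κ m x = κ n x := by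
    intro n m hnm x hx
    induction m, hnm using Nat.le_induction with
    | base => rfl
    | succ m hm ih => rw [hκ m x (hA hm hx), ih]
  have hlim : ∀ x, ∃ y, Tendsto (fun n => κ n x) atTop (𝓝 y) := by
    intro x
    refine cauchySeq_tendsto_of_complete (Metric.cauchySeq_iff'.2 fun ε hε => ?_)
    obtain ⟨d, hd, hxd⟩ := Metric.dense_iff.1 hd x (ε / 2) (half_pos hε)
    obtain ⟨N, hN⟩ := Set.mem_iUnion.1 hxd
    refine ⟨N, fun n hn => ?_⟩
    have h1 := dist_triangle (κ n x) (κ n d) (κ N x)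
    rw [(κ n).dist_eq, hκ' N n hn d hN, (κ N).dist_eq, dist_comm x d] at h1
    rw [Metric.mem_ball] at hd
    linarith
  choose F hF using hlim
  have hFκ : ∀ n, ∀ x ∈ A n, F x = κ n x := fun n x hx =>
    tendsto_nhds_unique (hF x) (tendsto_atTop_of_eventually_const fun m hm => hκ' n m hm x hx)
  have hiso : Isometry F := by
    refine Isometry.of_dist_eq fun x y => tendsto_nhds_unique ((hF x).dist (hF y)) ?_
    simp only [IsometryEquiv.dist_eq]
    exact tendsto_const_nhds
  have hsurj : Function.Surjective F := by
    rw [← Set.range_eq_univ, ← hiso.isClosedEmbedding.isClosed_range.closure_eq]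
    refine (hd'.mono ?_).closure_eq
    refine Set.iUnion_subset fun n => ?_
    rintro _ ⟨x, hx, rfl⟩
    exact ⟨x, hFκ n x hx⟩
  exact ⟨⟨Equiv.ofBijective F ⟨hiso.injective, hsurj⟩, hiso⟩, hFκ⟩

/-! ### Every isometry is a quotient of two products of four conjugates -/

/-- A growing sequence of walks that covers a dense sequence of points has a limit. -/
theorem exists_limit_walk [CompleteSpace U] {h : U ≃ᵢ U} {κ : ℕ → ℕ → (U ≃ᵢ U)} {E : ℕ → Set U}
    {p : ℕ → U} (hp : DenseRange p) (hE : Monotone E)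
    (hκ : ∀ n, WalkExtends h (κ n) (κ (n + 1)) (E n))
    (hc : ∀ n, WalkCovers h (κ (n + 1)) (E (n + 1)) {p n}) :
    ∃ K, ∀ n, WalkExtends h (κ n) K (E n) := by
  have hlim : ∀ i, ∃ K : U ≃ᵢ U, i < 4 → ∀ n,
      ∀ x ∈ conjWalk h (κ n) i '' E n ∪ conjWalk h (κ n) (i + 1) '' E n, K x = κ n i x := by
    intro i
    by_cases hi : i < 4
    · obtain ⟨K, hK⟩ := exists_limit_isometryEquiv (κ := fun n => κ n i)
        (A := fun n => conjWalk h (κ n) i '' E n ∪ conjWalk h (κ n) (i + 1) '' E n)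
        (monotone_nat_of_le_succ fun n => Set.union_subset_union
          ((hκ n).image_subset (hE n.le_succ) (by omega))
          ((hκ n).image_subset (hE n.le_succ) (by omega)))
        (fun n x hx => hκ n i hi x hx)
        (hp.mono (by
          rintro _ ⟨n, rfl⟩
          exact Set.mem_iUnion.2 ⟨n + 1, Or.inl ((hc n i hi).1 rfl)⟩))
        (hp.mono (by
          rintro _ ⟨n, rfl⟩
          exact Set.mem_iUnion.2 ⟨n + 1, Set.image_mono Set.subset_union_left ((hc n i hi).2 rfl)⟩))
      exact ⟨K, fun _ => hK⟩
    · exact ⟨1, fun hi' => absurd hi' hi⟩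
  choose K hK using hlim
  exact ⟨K, fun n i hi => hK i hi n⟩

/-- Given two walks on `E`, the first one good, whose end maps differ by `f` on `E`, the second one
extends to a good walk covering `F`, and the first one can be extended to match it. -/
theorem exists_extends_swap (hU : IsBoundedUrysohn U) {h : U ≃ᵢ U} (hh : MovesAlmostMaximally h)
    (f : U ≃ᵢ U) {κ l : ℕ → (U ≃ᵢ U)} {E F : Set U} (hE : E.Finite) (hF : F.Finite)
    (hG : WalkGood h κ E) (hf : ∀ x ∈ E, conjWalk h κ 4 x = f (conjWalk h l 4 x)) :
    ∃ κ' l' E', E ⊆ E' ∧ E'.Finite ∧ WalkExtends h κ κ' E ∧ WalkExtends h l l' E ∧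
      WalkGood h l' E' ∧ (∀ x ∈ E', conjWalk h κ' 4 x = f (conjWalk h l' 4 x)) ∧
      WalkCovers h l' E' F := by
  let E₁ : Set U := E ∪ ⋃ i ∈ Finset.range 4, (((conjWalk h l i)⁻¹ : U ≃ᵢ U) '' F ∪
    ((conjWalk h l i)⁻¹ : U ≃ᵢ U) '' (((l i)⁻¹ : U ≃ᵢ U) '' F))
  have hE₁ : E₁.Finite := hE.union (Set.Finite.biUnion (Finset.finite_toSet _) fun i _ =>
    (hF.image _).union ((hF.image _).image _))
  obtain ⟨l', E', hEE', hE', hl, hG'⟩ := exists_walkGood hU h l hE₁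
  have hEE : E ⊆ E₁ := Set.subset_union_left
  have hl' := hl.mono hEE
  obtain ⟨κ', hκ, hκ'⟩ := hG.exists_extends hU hh hE' (hEE.trans hEE') (f * conjWalk h l' 4)
    (fun x hx => by
      change _ = f (conjWalk h l' 4 x)
      rw [hf x hx, hl'.conjWalk_apply le_rfl hx])
  refine ⟨κ', l', E', hEE.trans hEE', hE', hκ, hl', hG', hκ', ?_⟩
  refine WalkCovers.extends (κ := l) (E := E₁)
    (fun i hi => ⟨fun y hy => ?_, fun y hy => ?_⟩) hl hEE'
  · exact ⟨(conjWalk h l i)⁻¹ y, Or.inr (Set.mem_biUnion (Finset.mem_range.2 hi)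
      (Or.inl ⟨y, hy, rfl⟩)), (conjWalk h l i).apply_inv_self y⟩
  · exact ⟨(l i)⁻¹ y, ⟨(conjWalk h l i)⁻¹ ((l i)⁻¹ y), Or.inr (Set.mem_biUnion
      (Finset.mem_range.2 hi) (Or.inr ⟨_, ⟨y, hy, rfl⟩, rfl⟩)),
      (conjWalk h l i).apply_inv_self _⟩, (l i).apply_inv_self y⟩

/-- The two walks are extended alternately: each of them, when good, can follow the other one,
which in turn becomes good by an extension that need not respect `f`. -/
theorem MovesAlmostMaximally.exists_eq_mul_inv (hU : IsBoundedUrysohn U) {h : U ≃ᵢ U}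
    (hh : MovesAlmostMaximally h) (f : U ≃ᵢ U) :
    ∃ κ l : ℕ → (U ≃ᵢ U), f = conjWalk h κ 4 * (conjWalk h l 4)⁻¹ := by
  have := hU.complete
  have := hU.separable
  have := hU.nonempty
  obtain ⟨p, hp⟩ := TopologicalSpace.exists_dense_seq U
  let S : Type _ := { s : (ℕ → (U ≃ᵢ U)) × (ℕ → (U ≃ᵢ U)) × Set U //
    s.2.2.Finite ∧ WalkGood h s.1 s.2.2 ∧
      ∀ x ∈ s.2.2, conjWalk h s.1 4 x = f (conjWalk h s.2.1 4 x) }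
  have hstep : ∀ (s : S) (n : ℕ), ∃ s' : S, s.1.2.2 ⊆ s'.1.2.2 ∧
      WalkExtends h s.1.1 s'.1.1 s.1.2.2 ∧ WalkExtends h s.1.2.1 s'.1.2.1 s.1.2.2 ∧
      WalkCovers h s'.1.1 s'.1.2.2 {p n} ∧ WalkCovers h s'.1.2.1 s'.1.2.2 {p n} := by
    rintro ⟨⟨κ, l, E⟩, hE, hG, hf⟩ n
    obtain ⟨κ₁, l₁, E₁, hEE₁, hE₁, hκ₁, hl₁, hG₁, hf₁, hc₁⟩ :=
      exists_extends_swap hU hh f hE (Set.finite_singleton (p n)) hG hf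
    obtain ⟨l₂, κ₂, E₂, hEE₂, hE₂, hl₂, hκ₂, hG₂, hf₂, hc₂⟩ :=
      exists_extends_swap hU hh f⁻¹ hE₁ (Set.finite_singleton (p n)) hG₁ (fun x hx => by
        rw [hf₁ x hx, f.inv_apply_self])
    exact ⟨⟨⟨κ₂, l₂, E₂⟩, hE₂, hG₂, fun x hx => by
      dsimp only
      rw [hf₂ x hx, f.apply_inv_self]⟩, hEE₁.trans hEE₂,
      hκ₁.trans hEE₁ hκ₂, hl₁.trans hEE₁ hl₂, hc₂, hc₁.extends hl₂ hEE₂⟩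
  choose next h1 h2 h3 h4 h5 using hstep
  let s₀ : S := ⟨⟨fun _ => 1, fun _ => 1, ∅⟩, Set.finite_empty, by simp [WalkGood, Indep], by simp⟩
  let s : ℕ → S := fun n => Nat.rec s₀ (fun n t => next t n) n
  have hmono : Monotone fun n => (s n).1.2.2 := monotone_nat_of_le_succ fun n => h1 (s n) n
  obtain ⟨K, hK⟩ := exists_limit_walk hp hmono (fun n => h2 (s n) n) (fun n => h4 (s n) n)
  obtain ⟨L, hL⟩ := exists_limit_walk hp hmono (fun n => h3 (s n) n) (fun n => h5 (s n) n)
  refine ⟨K, L, eq_mul_inv_of_mul_eq ?_⟩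
  have hrange : Set.EqOn (f * conjWalk h L 4 : U ≃ᵢ U) (conjWalk h K 4) (Set.range p) := by
    rintro _ ⟨n, rfl⟩
    have hmem : p n ∈ (s (n + 1)).1.2.2 := by
      have := (h4 (s n) n 0 (by norm_num)).1 rfl
      rwa [conjWalk_zero_image] at this
    change f (conjWalk h L 4 (p n)) = _
    rw [(hK (n + 1)).conjWalk_apply le_rfl hmem, (hL (n + 1)).conjWalk_apply le_rfl hmem,
      (s (n + 1)).2.2.2 _ hmem]
  exact DFunLike.coe_injective (Continuous.ext_on hp (IsometryEquiv.continuous _)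
    (IsometryEquiv.continuous _) hrange)

/-! ### Displacement of types -/

/-- The displacement `d(b, w b)` is at most `1`, and at most `d(b, x) + d(w x, y) + d(y, b)` for
all `x`, `y`, since `d(w x, w b) = d(x, b)`. The predicate says that, up to an error `η`, one of
these bounds for `x, y ∈ X` is attained, or the displacement is at least `c`. -/
def IsDisplaced (c η : ℝ) (w : U ≃ᵢ U) (X : Set U) (b : U) : Prop :=
  c - η ≤ dist b (w b) ∨ 1 - η ≤ dist b (w b) ∨
    ∃ x ∈ X, ∃ y ∈ X, dist b x + dist (w x) y + dist y b - η ≤ dist b (w b)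

/-- Every type over a finite set has a realisation that is displaced as far as possible, up to the
bound `c`. For `c = 1` this implies moving almost maximally, and smaller values of `c` allow to
reach that property in steps. -/
def DisplacesTypes (c : ℝ) (w : U ≃ᵢ U) : Prop :=
  ∀ X : Set U, X.Finite → ∀ a : U, ∃ b, RealisesType X a b ∧ IsDisplaced c 0 w X b

theorem DisplacesTypes.movesAlmostMaximally {c : ℝ} (hc : 1 ≤ c) {w : U ≃ᵢ U}
    (hw : DisplacesTypes c w) : MovesAlmostMaximally w := by
  intro X hX a
  obtain ⟨b, hb, hd⟩ := hw X hX a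
  refine ⟨b, hb, indep_of_le ?_⟩
  rintro b' rfl _ rfl
  rcases hd with h | h | ⟨x, hx, y, hy, h⟩
  · exact Or.inl (by linarith)
  · exact Or.inl (by linarith)
  · refine Or.inr ⟨y, hy, ?_⟩
    have h1 := dist_triangle y (w x) (w b')
    rw [w.dist_eq] at h1
    linarith [dist_comm y (w x), dist_comm x b', dist_comm y b']

theorem DisplacesTypes.conj {c : ℝ} {w : U ≃ᵢ U} (hw : DisplacesTypes c w) (φ : U ≃ᵢ U) :
    DisplacesTypes c (φ * w * φ⁻¹) := by
  intro X hX a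
  obtain ⟨b, hb, hd⟩ := hw ((φ⁻¹ : U ≃ᵢ U) '' X) (hX.image _) (φ⁻¹ a)
  have hφ : ∀ x y, dist x (φ⁻¹ y) = dist (φ x) y := fun x y => by
    rw [← φ.dist_eq, φ.apply_inv_self]
  have e : (φ * w * φ⁻¹) (φ b) = φ (w b) := congrArg (φ * w) (φ.inv_apply_self b)
  refine ⟨φ b, fun x hx => ?_, ?_⟩
  · have := hb _ ⟨x, hx, rfl⟩
    rwa [(φ⁻¹ : U ≃ᵢ U).dist_eq, hφ] at this
  · unfold IsDisplaced
    rw [e, φ.dist_eq]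
    refine hd.imp_right (Or.imp_right ?_)
    rintro ⟨_, ⟨x, hx, rfl⟩, _, ⟨y, hy, rfl⟩, h⟩
    rw [hφ, hφ, dist_comm _ b, hφ] at h
    refine ⟨x, hx, y, hy, ?_⟩
    rw [dist_comm y]
    exact h

/-- A type over `Y` has a realisation at a prescribed distance `r` from a further point `z`,
provided that `r` satisfies the triangle inequalities. -/
theorem IsBoundedUrysohn.exists_realisesType_dist_eq (hU : IsBoundedUrysohn U) {Y : Set U}
    (hY : Y.Finite) (p z : U) {r : ℝ} (hr0 : 0 ≤ r) (hr1 : r ≤ 1)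
    (h1 : ∀ y ∈ Y, dist p y ≤ r + dist y z) (h2 : ∀ y ∈ Y, r ≤ dist p y + dist y z)
    (h3 : ∀ y ∈ Y, dist y z ≤ dist p y + r) : ∃ e, RealisesType Y p e ∧ dist e z = r := by
  classical
  obtain ⟨e, he⟩ := hU.exists_dist_eq (hY.insert z) (fun x => if x = z then r else dist p x)
    (fun x _ => by
      split_ifs
      · exact hr1
      · exact hU.dist_le_one _ _)
    (by
      intro x hx y hy
      split_ifs with hxz hyz hyz
      · simp
      · rw [hxz, dist_comm z]
        exact h2 y (hy.resolve_left hyz)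
      · rw [hyz]
        exact h1 x (hx.resolve_left hxz)
      · linarith [dist_triangle p y x, dist_comm x y])
    (by
      intro x hx y hy
      split_ifs with hxz hyz hyz
      · rw [hxz, hyz, dist_self]
        linarith
      · rw [hxz, dist_comm z, add_comm]
        exact h3 y (hy.resolve_left hyz)
      · rw [hyz]
        exact h3 x (hx.resolve_left hxz)
      · linarith [dist_triangle x p y, dist_comm x p])
  have hez : dist e z = r := by simpa using he z (Or.inl rfl)
  refine ⟨e, fun x hx => ?_, hez⟩
  by_cases hxz : x = z
  · have h1 := h1 x hx
    have h2 := h2 x hx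
    rw [hxz, dist_self] at h1 h2
    rw [hxz, hez]
    linarith
  · simpa [hxz] using he x (Or.inr hx)

theorem Indep.le_dist {B : Set U} {a c : U} {r : ℝ} (h : Indep {a} B {c}) (hr : r ≤ 1)
    (hB : ∀ b ∈ B, r ≤ dist a b + dist b c) : r ≤ dist a c := by
  by_cases hlt : dist a c < 1
  · obtain ⟨b, hb, e⟩ := h a rfl c rfl hlt
    rw [e]
    exact hB b hb
  · exact hr.trans (not_lt.1 hlt)

/-- If some point is moved by distance `1`, then every type at distance at least `m ≤ 1/4` from its
base has a realisation that is moved by at least `m`. Each of the points `a₁`, `z` and the desired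
`e` owes its displacement to a difference between its distances to the previous point and
to the image of that point. -/
theorem IsBoundedUrysohn.exists_realisesType_le_dist (hU : IsBoundedUrysohn U) {g : U ≃ᵢ U} {a : U}
    (ha : dist a (g a) = 1) {Y : Set U} (hY : Y.Finite) (p : U) {m : ℝ} (hm : m ≤ 1 / 4)
    (hp : ∀ y ∈ Y, m ≤ dist p y) : ∃ e, RealisesType Y p e ∧ m ≤ dist e (g e) := by
  by_cases hm0 : m ≤ 0
  · exact ⟨p, fun _ _ => rfl, hm0.trans dist_nonneg⟩
  push Not at hm0
  have hW : (Y ∪ (g⁻¹ : U ≃ᵢ U) '' Y).Finite := hY.union (hY.image _)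
  set W := Y ∪ (g⁻¹ : U ≃ᵢ U) '' Y
  obtain ⟨a₀, ha₀⟩ := hU.exists_dist_eq (Set.finite_singleton a) (fun _ => 1 / 4)
    (by norm_num) (by simp) (by rintro _ rfl _ rfl; norm_num)
  obtain ⟨a₁, ha₁, hi₁⟩ := hU.exists_realisesType_indep (Set.finite_singleton a) hW a₀
  have h1 : dist a₁ a = 1 / 4 := (ha₁ a rfl).trans (ha₀ a rfl)
  have h1W : ∀ w ∈ W, 1 / 4 ≤ dist a₁ w := fun w hw =>
    (hi₁.mono subset_rfl (Set.singleton_subset_iff.2 hw)).le_dist (by norm_num) (by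
      rintro b rfl
      rw [h1]
      linarith [dist_nonneg (x := b) (y := w)])
  have h1g : 1 / 2 ≤ dist a₁ (g a₁) := by
    have h := dist_triangle4 a a₁ (g a₁) (g a)
    rw [g.dist_eq, ha, h1, dist_comm a, h1] at h
    linarith
  obtain ⟨z₀, hz₀⟩ := hU.exists_dist_eq (Set.finite_singleton a₁) (fun _ => 3 / 4)
    (by norm_num) (by simp) (by rintro _ rfl _ rfl; norm_num)
  obtain ⟨z, hz, hiz⟩ := hU.exists_realisesType_indep (Set.finite_singleton a₁)
    (hW.union (Set.finite_singleton (g a₁))) z₀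
  have h2 : dist z a₁ = 3 / 4 := (hz a₁ rfl).trans (hz₀ a₁ rfl)
  have h2W : ∀ w ∈ W, 1 ≤ dist z w := fun w hw =>
    (hiz.mono subset_rfl (Set.singleton_subset_iff.2 (Or.inl hw))).le_dist le_rfl (by
      rintro _ rfl
      rw [h2]
      linarith [h1W w hw])
  have h2g : 1 ≤ dist z (g a₁) :=
    (hiz.mono subset_rfl (Set.singleton_subset_iff.2 (Or.inr rfl))).le_dist le_rfl (by
      rintro _ rfl
      rw [h2]
      linarith)
  have h3 : 1 / 4 ≤ dist z (g z) := by
    have h := dist_triangle z (g z) (g a₁)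
    rw [g.dist_eq, h2] at h
    linarith
  obtain ⟨e₀, he₀, he₀z⟩ := hU.exists_realisesType_dist_eq hY p z (r := 1 - m) (by linarith)
    (by linarith)
    (fun y hy => by
      have := h2W y (Or.inl hy)
      rw [dist_comm] at this
      linarith [hU.dist_le_one p y])
    (fun y hy => by
      have := h2W y (Or.inl hy)
      rw [dist_comm] at this
      linarith [dist_nonneg (x := p) (y := y)])
    (fun y hy => by linarith [hU.dist_le_one y z, hp y hy])
  obtain ⟨e, he, hie⟩ := hU.exists_realisesType_indep (hY.union (Set.finite_singleton z))
    (Set.finite_singleton (g z)) e₀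
  have hez : dist e z = 1 - m := (he z (Or.inr rfl)).trans he₀z
  have hegz : 1 ≤ dist e (g z) := hie.le_dist le_rfl (by
    rintro y (hy | rfl)
    · have := h2W _ (Or.inr ⟨y, hy, rfl⟩)
      rw [← g.dist_eq, g.apply_inv_self, dist_comm] at this
      linarith [dist_nonneg (x := e) (y := y)]
    · rw [hez]
      linarith)
  refine ⟨e, fun y hy => (he y (Or.inl hy)).trans (he₀ y hy), ?_⟩
  have h := dist_triangle e (g e) (g z)
  rw [g.dist_eq, hez] at h
  linarith

/-- To displace a type `tp(a/X)` as far as possible, take `z` at distance `1/4` beyond `a` as seen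
from the base, and moved by at least `1/4`. A realisation at distance `1/4` from `z` and as far as
possible from `g z` is displaced as desired. -/
theorem IsBoundedUrysohn.displacesTypes (hU : IsBoundedUrysohn U) {g : U ≃ᵢ U} {a₀ : U}
    (ha₀ : dist a₀ (g a₀) = 1) : DisplacesTypes (1 / 4) g := by
  intro X hX a
  have hX' : ((g⁻¹ : U ≃ᵢ U) '' X).Finite := hX.image _
  obtain ⟨a', ha', hi⟩ := hU.exists_realisesType_indep hX hX' a
  have hF : (X ∪ (g⁻¹ : U ≃ᵢ U) '' X).Finite := hX.union hX'
  obtain ⟨z₁, hz₁⟩ := hU.exists_dist_eq (Set.finite_singleton a') (fun _ => 1 / 4)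
    (by norm_num) (by simp) (by rintro _ rfl _ rfl; norm_num)
  obtain ⟨z₀, hz₀, hi₀⟩ := hU.exists_realisesType_indep (Set.finite_singleton a') hF z₁
  have h0 : dist z₀ a' = 1 / 4 := (hz₀ a' rfl).trans (hz₁ a' rfl)
  have h0F : ∀ w ∈ X ∪ (g⁻¹ : U ≃ᵢ U) '' X, 1 / 4 ≤ dist z₀ w := fun w hw =>
    (hi₀.mono subset_rfl (Set.singleton_subset_iff.2 hw)).le_dist (by norm_num) (by
      rintro b rfl
      rw [h0]
      linarith [dist_nonneg (x := b) (y := w)])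
  obtain ⟨z, hz, hgz⟩ := hU.exists_realisesType_le_dist ha₀ hF z₀ le_rfl h0F
  obtain ⟨φ, hφ, rfl⟩ := (realisesType_iff hU hF _ _).1 hz
  obtain ⟨e, he, hie⟩ := hU.exists_realisesType_indep (hX.union (Set.finite_singleton (φ z₀)))
    (Set.finite_singleton (g (φ z₀))) (φ a')
  have hez : dist e (φ z₀) = 1 / 4 := by
    rw [he _ (Or.inr rfl), φ.dist_eq, dist_comm, h0]
  have heX : ∀ x ∈ X, dist e x = dist a x := fun x hx => by
    rw [he x (Or.inl hx), ← ha' x hx]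
    conv_lhs => rw [← hφ x (Or.inl hx)]
    exact φ.dist_eq _ _
  refine ⟨e, heX, ?_⟩
  have hmove : dist e (g (φ z₀)) - 1 / 4 ≤ dist e (g e) := by
    have h := dist_triangle e (g e) (g (φ z₀))
    rw [g.dist_eq, hez] at h
    linarith
  by_cases hlt : dist e (g (φ z₀)) < 1
  swap
  · exact Or.inl (by linarith)
  obtain ⟨x, hx | rfl, hd⟩ := hie e rfl _ rfl hlt
  swap
  · exact Or.inl (by linarith)
  have hx' : g⁻¹ x ∈ X ∪ (g⁻¹ : U ≃ᵢ U) '' X := Or.inr ⟨x, hx, rfl⟩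
  have hxz : dist x (g (φ z₀)) = dist z₀ (g⁻¹ x) := by
    conv_lhs => rw [← g.apply_inv_self x]
    rw [g.dist_eq]
    conv_lhs => rw [← hφ _ hx']
    rw [φ.dist_eq, dist_comm]
  by_cases hlt₀ : dist z₀ (g⁻¹ x) < 1
  swap
  · exact Or.inl (by linarith [dist_nonneg (x := e) (y := x)])
  obtain ⟨a'', ha'', hd₀⟩ := hi₀ z₀ rfl _ hx' hlt₀
  rw [Set.mem_singleton_iff.1 ha'', h0] at hd₀
  by_cases hlt' : dist a' (g⁻¹ x) < 1
  swap
  · exact Or.inl (by linarith [dist_nonneg (x := e) (y := x)])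
  obtain ⟨y, hy, hd'⟩ := hi a' rfl _ ⟨x, hx, rfl⟩ hlt'
  refine Or.inr (Or.inr ⟨y, hy, x, hx, ?_⟩)
  have hyx : dist y (g⁻¹ x) = dist (g y) x := by
    rw [← g.dist_eq, g.apply_inv_self]
  have := ha' y hy
  rw [heX y hy, dist_comm x e]
  linarith

/-! ### Doubling the displacement -/

/-- If `u` and `v` displace types up to `c`, then `u` can be conjugated by an isometry that fixes a
given finite set so that the product with `v` displaces a given type up to `2c`. -/
theorem IsBoundedUrysohn.exists_conj_isDisplaced (hU : IsBoundedUrysohn U) {c : ℝ} {u v : U ≃ᵢ U}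
    (hu : DisplacesTypes c u) (hv : DisplacesTypes c v) {A X : Set U} (hA : A.Finite)
    (hX : X.Finite) (a : U) : ∃ φ : U ≃ᵢ U, (∀ x ∈ A, φ x = x) ∧
      ∃ b, RealisesType X a b ∧ IsDisplaced (2 * c) 0 (φ * u * φ⁻¹ * v) X b := by
  have hBf : (A ∪ (X ∪ (v '' X ∪ u '' (v '' X)))).Finite :=
    hA.union (hX.union ((hX.image _).union ((hX.image _).image _)))
  set B : Set U := A ∪ (X ∪ (v '' X ∪ u '' (v '' X)))
  have hXB : ∀ x ∈ X, x ∈ B := fun x hx => Or.inr (Or.inl hx)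
  have hvB : ∀ x ∈ X, v x ∈ B := fun x hx => Or.inr (Or.inr (Or.inl ⟨x, hx, rfl⟩))
  have huvB : ∀ x ∈ X, u (v x) ∈ B := fun x hx =>
    Or.inr (Or.inr (Or.inr ⟨_, ⟨x, hx, rfl⟩, rfl⟩))
  have hFf : (B ∪ (v⁻¹ : U ≃ᵢ U) '' B).Finite := hBf.union (hBf.image _)
  set F : Set U := B ∪ (v⁻¹ : U ≃ᵢ U) '' B
  obtain ⟨a', ha', hi'⟩ := hU.exists_realisesType_indep hX hFf a
  obtain ⟨b, hb, hbv⟩ := hv (X ∪ F) (hX.union hFf) a'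
  have hi : Indep {b} X (X ∪ F) :=
    (indep_of_subset subset_rfl).symm.union_right (hb.indep hU hX hFf hi')
  obtain ⟨β, hβ, hβu⟩ := hu B hBf b
  obtain ⟨φ₁, hφ₁, hφ₁b⟩ := (realisesType_iff hU hBf β b).1 fun x hx => (hβ x hx).symm
  obtain ⟨q, hq, hqi⟩ := hU.exists_realisesType_indep (hBf.union (Set.finite_singleton b))
    (Set.finite_singleton (v b)) (φ₁ (u⁻¹ β))
  obtain ⟨φ₂, hφ₂, hφ₂q⟩ := (realisesType_iff hU (hBf.union (Set.finite_singleton b)) _ _).1 hq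
  let φ : U ≃ᵢ U := φ₂ * φ₁
  have hφ : ∀ x ∈ B, φ x = x := fun x hx => by
    change φ₂ (φ₁ x) = x
    rw [hφ₁ x hx, hφ₂ x (Or.inl hx)]
  have hφβ : φ β = b := by
    change φ₂ (φ₁ β) = b
    rw [hφ₁b, hφ₂ b (Or.inr rfl)]
  have hφq : φ (u⁻¹ β) = q := hφ₂q
  have hwq : (φ * u * φ⁻¹) q = b := by
    change φ (u (φ⁻¹ q)) = b
    rw [← hφq, φ.inv_apply_self, u.apply_inv_self, hφβ]
  have hD : ∀ x, dist b ((φ * u * φ⁻¹) x) = dist q x := fun x => by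
    conv_lhs => rw [← hwq]
    exact (φ * u * φ⁻¹).dist_eq _ _
  have hwv : ∀ x ∈ X, (φ * u * φ⁻¹) (v x) = u (v x) := fun x hx =>
    conj_apply_of_fixed (hφ _ (hvB x hx)) (hφ _ (huvB x hx))
  have hqb : dist q b = dist β (u β) := by
    rw [← hφq, ← hφβ, φ.dist_eq, dist_comm, ← u.dist_eq, u.apply_inv_self, dist_comm]
  -- Paths from `q` to `v b` through `v x`, for `x ∈ X`, are long enough.
  have key₁ : ∀ x ∈ X, dist b x + dist q (v x) ≤ dist q (v b) →
      IsDisplaced (2 * c) 0 (φ * u * φ⁻¹ * v) X b := by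
    intro x hx h
    have e : dist b (u (v x)) = dist q (v x) := by rw [← hwv x hx, hD]
    have hd : dist b ((φ * u * φ⁻¹ * v) b) = dist q (v b) := hD (v b)
    by_cases hlt : dist b (u (v x)) < 1
    · obtain ⟨y, hy, hy'⟩ := hi b rfl _ (Or.inr (Or.inl (huvB x hx))) hlt
      refine Or.inr (Or.inr ⟨x, hx, y, hy, ?_⟩)
      rw [hd]
      change dist b x + dist ((φ * u * φ⁻¹) (v x)) y + dist y b - 0 ≤ _
      rw [hwv x hx]
      linarith [dist_comm y b, dist_comm y (u (v x))]
    · refine Or.inr (Or.inl ?_)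
      rw [hd]
      linarith [dist_nonneg (x := b) (y := x)]
  -- So are paths through `B`.
  have key₂ : ∀ y ∈ B, dist q y + dist y (v b) ≤ dist q (v b) →
      IsDisplaced (2 * c) 0 (φ * u * φ⁻¹ * v) X b := by
    intro y hy h
    have e : dist y (v b) = dist b (v⁻¹ y) := by
      rw [← v.dist_eq b, v.apply_inv_self, dist_comm]
    by_cases hlt : dist b (v⁻¹ y) < 1
    · obtain ⟨x, hx, hx'⟩ := hi b rfl _ (Or.inr (Or.inr ⟨y, hy, rfl⟩)) hlt
      rw [← v.dist_eq x, v.apply_inv_self] at hx'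
      exact key₁ x hx (by linarith [dist_triangle q y (v x), dist_comm y (v x)])
    · refine Or.inr (Or.inl ?_)
      change 1 - 0 ≤ dist b ((φ * u * φ⁻¹) (v b))
      rw [hD]
      linarith [dist_nonneg (x := q) (y := y)]
  refine ⟨φ, fun x hx => hφ x (Or.inl hx), b,
    fun x hx => (hb x (Or.inl hx)).trans (ha' x hx), ?_⟩
  have hone : 1 ≤ dist q (v b) → IsDisplaced (2 * c) 0 (φ * u * φ⁻¹ * v) X b := fun h =>
    Or.inr (Or.inl (by
      change 1 - 0 ≤ dist b ((φ * u * φ⁻¹) (v b))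
      rw [hD]
      linarith))
  by_cases hlt : dist q (v b) < 1
  swap
  · exact hone (not_lt.1 hlt)
  obtain ⟨y, hy | rfl, hy'⟩ := hqi q rfl _ rfl hlt
  · exact key₂ y hy hy'.ge
  -- A path through `b` has length `d(β, u β) + d(b, v b)`.
  have htight : ∀ z ∈ X ∪ F, dist y z < 1 → ∃ x ∈ X, dist y z = dist y x + dist x z :=
    fun z hz => hi y rfl z hz
  have hvy : dist y (v y) < 1 := by linarith [dist_nonneg (x := q) (y := y)]
  have huβ : dist β (u β) < 1 := by linarith [dist_nonneg (x := y) (y := v y)]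
  rcases hbv with hcv | h | ⟨z, hz, z', hz', h⟩
  · rcases hβu with hcu | h | ⟨z, hz, z', hz', h⟩
    · refine Or.inl ?_
      change 2 * c - 0 ≤ dist y ((φ * u * φ⁻¹) (v y))
      rw [hD]
      linarith
    · linarith
    · have hβz := hβ z hz
      obtain ⟨x, hx, hx'⟩ := htight z (Or.inr (Or.inl hz)) (by
        linarith [dist_nonneg (x := u z) (y := z'), dist_nonneg (x := z') (y := β)])
      refine key₂ x (hXB x hx) ?_
      have e : dist q x = dist (u x) β := by
        conv_lhs => rw [← hφq, ← hφ x (hXB x hx), φ.dist_eq, ← u.dist_eq, u.apply_inv_self]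
        exact dist_comm _ _
      have h1 := dist_triangle4 (u x) (u z) z' β
      rw [u.dist_eq] at h1
      linarith [dist_triangle x y (v y), dist_comm x y]
  · linarith
  · obtain ⟨x, hx, hx'⟩ := htight z hz (by
      linarith [dist_nonneg (x := v z) (y := z'), dist_nonneg (x := z') (y := y)])
    refine key₁ x hx ?_
    have h1 := dist_triangle4 (v x) (v z) z' y
    rw [v.dist_eq] at h1
    linarith [dist_triangle q y (v x), dist_comm y (v x)]

/-- It suffices to displace types with arbitrarily small errors: from a realisation `b` with error
`ε` one gets a better one by displacing a type over `X ∪ {b}` at distance `ε` from `b`, and this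
gives a Cauchy sequence of realisations. -/
theorem displacesTypes_of_forall_pos (hU : IsBoundedUrysohn U) {c : ℝ} {w : U ≃ᵢ U}
    (hw : ∀ X : Set U, X.Finite → ∀ a : U, ∀ η > 0,
      ∃ b, RealisesType X a b ∧ IsDisplaced c η w X b) : DisplacesTypes c w := by
  have := hU.complete
  intro X hX a
  by_cases haX : a ∈ X
  · exact ⟨a, fun _ _ => rfl, Or.inr (Or.inr ⟨a, haX, a, haX, by simp [dist_comm]⟩)⟩
  obtain ⟨t, ⟨ht0, htc, ht1, htX⟩⟩ : ∃ t : ℝ, (t = c ∨ t = 1 ∨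
      ∃ x ∈ X, ∃ y ∈ X, t = dist a x + dist (w x) y + dist y a) ∧ t ≤ c ∧ t ≤ 1 ∧
      ∀ x ∈ X, ∀ y ∈ X, t ≤ dist a x + dist (w x) y + dist y a := by
    obtain ⟨t, ht, hmin⟩ := Set.exists_min_image
      ({c, 1} ∪ Set.image2 (fun x y => dist a x + dist (w x) y + dist y a) X X) id
      ((Set.toFinite _).union (hX.image2 _ hX)) ⟨c, by simp⟩
    refine ⟨t, ?_, hmin c (by simp), hmin 1 (by simp),
      fun x hx y hy => hmin _ (Or.inr ⟨x, hx, y, hy, rfl⟩)⟩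
    rcases ht with (rfl | rfl) | ⟨x, hx, y, hy, rfl⟩
    · exact Or.inl rfl
    · exact Or.inr (Or.inl rfl)
    · exact Or.inr (Or.inr ⟨x, hx, y, hy, rfl⟩)
  obtain ⟨r, hr0, hr1, hrX⟩ : ∃ r : ℝ, 0 < r ∧ r ≤ 1 ∧ ∀ x ∈ X, r ≤ dist a x := by
    obtain ⟨r, hr, hmin⟩ := Set.exists_min_image ({1} ∪ (fun x => dist a x) '' X) id
      ((Set.toFinite _).union (hX.image _)) ⟨1, by simp⟩
    refine ⟨r, ?_, hmin 1 (by simp), fun x hx => hmin _ (Or.inr ⟨x, hx, rfl⟩)⟩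
    rcases hr with rfl | ⟨x, hx, rfl⟩
    · exact one_pos
    · exact dist_pos.2 fun h => haX (h ▸ hx)
  have hstep : ∀ ε, 0 < ε → ε ≤ r → ∀ η > 0, ∀ b, RealisesType X a b → t - ε ≤ dist b (w b) →
      ∃ b', RealisesType X a b' ∧ t - η ≤ dist b' (w b') ∧ dist b b' = ε := by
    intro ε hε hεr η hη b hb hbt
    obtain ⟨e, he, heb⟩ := hU.exists_realisesType_dist_eq hX b b hε.le (hεr.trans hr1)
      (fun y _ => by linarith [dist_comm y b])
      (fun y hy => by linarith [hb y hy, hrX y hy, dist_nonneg (x := y) (y := b)])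
      (fun y _ => by linarith [dist_comm y b])
    obtain ⟨b', hb', hd⟩ := hw (X ∪ {b}) (hX.union (Set.finite_singleton b)) e η hη
    have hb'X : ∀ x ∈ X, dist b' x = dist b x := fun x hx =>
      (hb' x (Or.inl hx)).trans (he x hx)
    have hb'b : dist b' b = ε := (hb' b (Or.inr rfl)).trans heb
    refine ⟨b', fun x hx => (hb'X x hx).trans (hb x hx), ?_, by rw [dist_comm, hb'b]⟩
    rcases hd with h | h | ⟨x, hx | rfl, y, hy | rfl, h⟩
    · linarith
    · linarith
    · linarith [htX x hx y hy, hb'X x hx, hb x hx, hb'X y hy, hb y hy, dist_comm y b',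
        dist_comm y a]
    · have h1 := dist_triangle y (w x) (w y)
      rw [w.dist_eq] at h1
      linarith [hb'X x hx, dist_comm x y, dist_comm y (w x), dist_comm y b']
    · linarith [hb'X y hy, dist_triangle x y (w x), dist_comm y (w x), dist_comm x y,
        dist_comm b' y]
    · linarith [dist_comm (w y) y, dist_comm y b']
  have hε : ∀ n : ℕ, 0 < r / 2 / 2 ^ n := fun n => by positivity
  have hεr : ∀ n : ℕ, r / 2 / 2 ^ n ≤ r := fun n => by
    refine (div_le_self (half_pos hr0).le (one_le_pow₀ one_le_two)).trans ?_
    linarith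
  let S : ℕ → Type _ := fun n => { b : U // RealisesType X a b ∧ t - r / 2 / 2 ^ n ≤ dist b (w b) }
  have hnext : ∀ n, ∀ b : S n, ∃ b' : S (n + 1), dist b.1 b'.1 = r / 2 / 2 ^ n := by
    rintro n ⟨b, hb, hbt⟩
    obtain ⟨b', hb', ht', hd⟩ := hstep _ (hε n) (hεr n) _ (hε (n + 1)) b hb hbt
    exact ⟨⟨b', hb', ht'⟩, hd⟩
  choose next hdist using hnext
  obtain ⟨b₀, hb₀, hd₀⟩ := hw X hX a _ (hε 0)
  have hb₀t : t - r / 2 / 2 ^ 0 ≤ dist b₀ (w b₀) := by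
    rcases hd₀ with h | h | ⟨x, hx, y, hy, h⟩
    · linarith
    · linarith
    · linarith [htX x hx y hy, hb₀ x hx, hb₀ y hy, dist_comm y b₀, dist_comm y a]
  let s : (n : ℕ) → S n := fun n => Nat.rec ⟨b₀, hb₀, hb₀t⟩ (fun n b => next n b) n
  have hcauchy : CauchySeq fun n => (s n).1 :=
    cauchySeq_of_le_geometric_two fun n => (hdist n (s n)).le
  obtain ⟨b, hb⟩ := cauchySeq_tendsto_of_complete hcauchy
  have hbX : RealisesType X a b := fun x hx =>
    tendsto_nhds_unique (hb.dist tendsto_const_nhds)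
      (tendsto_const_nhds.congr fun n => ((s n).2.1 x hx).symm)
  have hbt : t ≤ dist b (w b) := by
    have h1 : Filter.Tendsto (fun n : ℕ => t - r / 2 / 2 ^ n) Filter.atTop (nhds (t - 0)) :=
      tendsto_const_nhds.sub (by
        simpa [div_eq_mul_inv] using
          (tendsto_pow_atTop_nhds_zero_of_lt_one (r := (1 / 2 : ℝ)) (by norm_num)
            (by norm_num)).const_mul (r / 2))
    rw [sub_zero] at h1
    exact le_of_tendsto_of_tendsto' h1 (hb.dist ((w.continuous.tendsto b).comp hb))
      fun n => (s n).2.2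
  refine ⟨b, hbX, ?_⟩
  rcases ht0 with rfl | rfl | ⟨x, hx, y, hy, e⟩
  · exact Or.inl (by linarith)
  · exact Or.inr (Or.inl (by linarith))
  · refine Or.inr (Or.inr ⟨x, hx, y, hy, ?_⟩)
    linarith [hbX x hx, hbX y hy, dist_comm y b, dist_comm y a]

/-- It suffices to displace the types of points of a dense sequence over finite sets of such
points. -/
theorem displacesTypes_of_denseRange (hU : IsBoundedUrysohn U) {c : ℝ} {w : U ≃ᵢ U} {p : ℕ → U}
    (hp : DenseRange p) (hw : ∀ (I : Finset ℕ) (j : ℕ),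
      ∃ b, RealisesType (p '' I) (p j) b ∧ IsDisplaced c 0 w (p '' I) b) :
    DisplacesTypes c w := by
  refine displacesTypes_of_forall_pos hU fun X hX a η hη => ?_
  obtain ⟨δ, hδ, rfl⟩ : ∃ δ, 0 < δ ∧ η = 12 * δ := ⟨η / 12, by positivity, by ring⟩
  have happ : ∀ x, ∃ n, dist x (p n) < δ := fun x => hp.exists_dist_lt x hδ
  choose n hn using happ
  obtain ⟨b₀, hb₀, hd⟩ := hw (hX.toFinset.image n) (n a)
  have hmem : ∀ x ∈ X, p (n x) ∈ p '' (hX.toFinset.image n : Finset ℕ) := fun x hx =>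
    ⟨n x, by simpa using ⟨x, hx, rfl⟩, rfl⟩
  have hclose : ∀ x ∈ X, |dist a x - dist b₀ x| ≤ 3 * δ := fun x hx => by
    have h1 := hb₀ _ (hmem x hx)
    have h2 := abs_le.1 (abs_dist_sub_le b₀ b₀ x)
    rw [abs_le]
    constructor
    · linarith [dist_triangle b₀ (p (n x)) x, dist_triangle4 (p (n a)) a x (p (n x)), hn a, hn x,
        dist_comm a (p (n a)), dist_comm x (p (n x))]
    · linarith [dist_triangle4 a (p (n a)) (p (n x)) x, dist_triangle b₀ x (p (n x)), hn a, hn x,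
        dist_comm x (p (n x))]
  obtain ⟨r, hr, hr0, hrX⟩ : ∃ r : ℝ, (r = 0 ∨ ∃ x ∈ X, r = |dist a x - dist b₀ x|) ∧ 0 ≤ r ∧
      ∀ x ∈ X, |dist a x - dist b₀ x| ≤ r := by
    obtain ⟨r, hr, hmax⟩ := Set.exists_max_image ({0} ∪ (fun x => |dist a x - dist b₀ x|) '' X) id
      ((Set.toFinite _).union (hX.image _)) ⟨0, by simp⟩
    refine ⟨r, ?_, hmax 0 (by simp), fun x hx => hmax _ (Or.inr ⟨x, hx, rfl⟩)⟩
    rcases hr with rfl | ⟨x, hx, rfl⟩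
    · exact Or.inl rfl
    · exact Or.inr ⟨x, hx, rfl⟩
  have hr3 : r ≤ 3 * δ := by
    rcases hr with rfl | ⟨x, hx, rfl⟩
    · positivity
    · exact hclose x hx
  have hrd : r ≤ dist a b₀ := by
    rcases hr with rfl | ⟨x, hx, rfl⟩
    · exact dist_nonneg
    · exact abs_dist_sub_le a b₀ x
  obtain ⟨b, hb, hbr⟩ := hU.exists_realisesType_dist_eq hX a b₀ hr0
    (hrd.trans (hU.dist_le_one _ _))
    (fun x hx => by linarith [(abs_le.1 (hrX x hx)).2, dist_comm x b₀])
    (fun x _ => hrd.trans (dist_triangle _ _ _))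
    (fun x hx => by linarith [(abs_le.1 (hrX x hx)).1, dist_comm x b₀])
  have hD : dist b₀ (w b₀) - 6 * δ ≤ dist b (w b) := by
    have h := dist_triangle4 b₀ b (w b) (w b₀)
    rw [w.dist_eq, dist_comm b₀ b] at h
    linarith
  refine ⟨b, hb, ?_⟩
  rcases hd with h | h | ⟨_, ⟨i, hi, rfl⟩, _, ⟨j, hj, rfl⟩, h⟩
  · exact Or.inl (by linarith)
  · exact Or.inr (Or.inl (by linarith))
  · obtain ⟨x, hx, rfl⟩ : ∃ x ∈ X, n x = i := by simpa using hi
    obtain ⟨y, hy, rfl⟩ : ∃ y ∈ X, n y = j := by simpa using hj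
    have hnear : ∀ x ∈ X, dist b x ≤ dist b₀ (p (n x)) + 2 * δ := fun x hx => by
      rw [hb x hx, hb₀ _ (hmem x hx)]
      linarith [dist_triangle4 a (p (n a)) (p (n x)) x, hn a, hn x, dist_comm x (p (n x))]
    have h4 := dist_triangle4 (w x) (w (p (n x))) (p (n y)) y
    rw [w.dist_eq] at h4
    refine Or.inr (Or.inr ⟨x, hx, y, hy, ?_⟩)
    linarith [hnear x hx, hnear y hy, hn x, hn y, dist_comm y (p (n y)), dist_comm y b,
      dist_comm (p (n y)) b₀]

theorem IsDisplaced.congr {c η : ℝ} {w w' : U ≃ᵢ U} {X : Set U} {b : U}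
    (h : IsDisplaced c η w X b) (hb : w' b = w b) (hX : ∀ x ∈ X, w' x = w x) :
    IsDisplaced c η w' X b := by
  unfold IsDisplaced
  rw [hb]
  refine h.imp_right (Or.imp_right ?_)
  rintro ⟨x, hx, y, hy, h⟩
  exact ⟨x, hx, y, hy, by rwa [hX x hx]⟩

/-- The displacement of types can be doubled by multiplying with a conjugate. The conjugating
isometry is built in countably many steps, each of which displaces one type over a finite part of
a dense sequence. -/
theorem DisplacesTypes.exists_double (hU : IsBoundedUrysohn U) {c : ℝ} {v : U ≃ᵢ U}
    (hv : DisplacesTypes c v) : ∃ κ : U ≃ᵢ U, DisplacesTypes (2 * c) (κ⁻¹ * v * κ * v) := by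
  have := hU.complete
  have := hU.separable
  have := hU.nonempty
  obtain ⟨p, hp⟩ := TopologicalSpace.exists_dense_seq U
  obtain ⟨r, hr⟩ := exists_surjective_nat (Finset ℕ × ℕ)
  have hstep : ∀ (s : { s : (U ≃ᵢ U) × Set U // s.2.Finite }) (n : ℕ),
      ∃ s' : { s : (U ≃ᵢ U) × Set U // s.2.Finite }, s.1.2 ⊆ s'.1.2 ∧
      (∀ x ∈ s.1.2, s'.1.1 x = s.1.1 x) ∧ p n ∈ s'.1.2 ∧ p n ∈ s'.1.1 '' s'.1.2 ∧
      ∃ b, RealisesType (p '' (r n).1) (p (r n).2) b ∧ ∀ K : U ≃ᵢ U,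
        (∀ x ∈ s'.1.2, K x = s'.1.1 x) →
          IsDisplaced (2 * c) 0 (K⁻¹ * v * K * v) (p '' (r n).1) b := by
    rintro ⟨⟨κ, A⟩, hA⟩ n
    have hX : (p '' ((r n).1 : Set ℕ)).Finite := (Finset.finite_toSet _).image p
    set X := p '' ((r n).1 : Set ℕ)
    have hu : DisplacesTypes c (κ⁻¹ * v * κ) := by simpa using hv.conj κ⁻¹
    obtain ⟨φ, hφ, b, hb, hd⟩ := hU.exists_conj_isDisplaced hu hv hA hX (p (r n).2)
    set κ' : U ≃ᵢ U := κ * φ⁻¹ with hκ'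
    have hw : φ * (κ⁻¹ * v * κ) * φ⁻¹ = κ'⁻¹ * v * κ' := by rw [hκ']; group
    rw [hw] at hd
    let T : Set U := insert (v b) (v '' X)
    have hT : T.Finite := (hX.image _).insert _
    let A' : Set U := A ∪ {p n, κ'⁻¹ (p n)} ∪ (T ∪ (κ'⁻¹ * v * κ' : U ≃ᵢ U) '' T)
    have hA' : A'.Finite := (hA.union (Set.toFinite _)).union (hT.union (hT.image _))
    refine ⟨⟨⟨κ', A'⟩, hA'⟩, fun x hx => Or.inl (Or.inl hx), fun x hx => ?_,
      Or.inl (Or.inr (Or.inl rfl)), ⟨κ'⁻¹ (p n), Or.inl (Or.inr (Or.inr rfl)),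
        κ'.apply_inv_self _⟩, b, hb, fun K hK => ?_⟩
    · change κ (φ⁻¹ x) = κ x
      rw [inv_apply_eq_self (hφ x hx)]
    · have hKT : ∀ z ∈ T, (K⁻¹ * v * K) z = (κ'⁻¹ * v * κ') z := fun z hz => by
        have h1 : K z = κ' z := hK z (Or.inr (Or.inl hz))
        have h2 : K ((κ'⁻¹ * v * κ') z) = κ' ((κ'⁻¹ * v * κ') z) :=
          hK _ (Or.inr (Or.inr ⟨z, hz, rfl⟩))
        have h3 : κ' ((κ'⁻¹ * v * κ') z) = v (κ' z) := κ'.apply_inv_self _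
        change K⁻¹ (v (K z)) = _
        rw [h1, ← h3, ← h2, K.inv_apply_self]
      exact hd.congr (hKT _ (Or.inl rfl)) fun x hx => hKT _ (Or.inr ⟨x, hx, rfl⟩)
  choose next h1 h2 h3 h4 h5 using hstep
  let s : ℕ → { s : (U ≃ᵢ U) × Set U // s.2.Finite } := fun n =>
    Nat.rec ⟨⟨1, ∅⟩, Set.finite_empty⟩ (fun n t => next t n) n
  obtain ⟨K, hK⟩ := exists_limit_isometryEquiv (κ := fun n => (s n).1.1) (A := fun n => (s n).1.2)
    (monotone_nat_of_le_succ fun n => h1 (s n) n) (fun n => h2 (s n) n)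
    (hp.mono (by
      rintro _ ⟨n, rfl⟩
      exact Set.mem_iUnion.2 ⟨n + 1, h3 (s n) n⟩))
    (hp.mono (by
      rintro _ ⟨n, rfl⟩
      exact Set.mem_iUnion.2 ⟨n + 1, h4 (s n) n⟩))
  refine ⟨K, displacesTypes_of_denseRange hU hp fun I j => ?_⟩
  obtain ⟨n, hn⟩ := hr (I, j)
  obtain ⟨b, hb, hd⟩ := h5 (s n) n
  rw [hn] at hb hd
  exact ⟨b, hb, hd K (hK (n + 1))⟩

theorem IsBoundedUrysohn.exists_list_displacesTypes (hU : IsBoundedUrysohn U) {g : U ≃ᵢ U}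
    (hg : ∃ a : U, dist a (g a) = 1) (n : ℕ) :
    ∃ l : List (U ≃ᵢ U), l.length = 2 ^ n ∧ (∀ k ∈ l, IsConj g k) ∧
      DisplacesTypes (2 ^ n * (1 / 4)) l.prod := by
  induction n with
  | zero =>
    obtain ⟨a, ha⟩ := hg
    exact ⟨[g], rfl, fun k hk => by rw [List.mem_singleton.1 hk], by
      simpa using hU.displacesTypes ha⟩
  | succ n ih =>
    obtain ⟨l, hl, hconj, hd⟩ := ih
    obtain ⟨κ, hκ⟩ := hd.exists_double hU
    refine ⟨l.map (MulAut.conj κ⁻¹) ++ l, ?_, fun k hk => ?_, ?_⟩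
    · rw [List.length_append, List.length_map, hl, pow_succ]
      ring
    · rcases List.mem_append.1 hk with hk | hk
      · obtain ⟨k', hk', rfl⟩ := List.mem_map.1 hk
        exact (hconj k' hk').trans (isConj_iff.2 ⟨κ⁻¹, rfl⟩)
      · exact hconj k hk
    · rw [List.prod_append, ← map_list_prod, MulAut.conj_apply, inv_inv, pow_succ']
      rwa [mul_assoc 2]

/-! ### Products of conjugates of `g` and its inverse -/

/-- `f` is a product of `n` elements, each a conjugate of `g` or of `g⁻¹`. -/
def IsConjProd {G : Type*} [Group G] (g : G) (n : ℕ) (f : G) : Prop :=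
  ∃ l : List G, l.length = n ∧ (∀ k ∈ l, IsConj g k ∨ IsConj g⁻¹ k) ∧ l.prod = f

theorem IsConjProd.mul {G : Type*} [Group G] {g : G} {m n : ℕ} {x y : G} (hx : IsConjProd g m x)
    (hy : IsConjProd g n y) : IsConjProd g (m + n) (x * y) := by
  obtain ⟨l, rfl, hl, rfl⟩ := hx
  obtain ⟨l', rfl, hl', rfl⟩ := hy
  exact ⟨l ++ l', List.length_append, fun k hk => (List.mem_append.1 hk).elim (hl k) (hl' k),
    List.prod_append⟩

theorem IsConjProd.conj {G : Type*} [Group G] {g : G} {n : ℕ} {x : G} (hx : IsConjProd g n x)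
    (c : G) : IsConjProd g n (c * x * c⁻¹) := by
  obtain ⟨l, rfl, hl, rfl⟩ := hx
  refine ⟨l.map (MulAut.conj c), List.length_map _, fun k hk => ?_, by
    rw [← map_list_prod, MulAut.conj_apply]⟩
  obtain ⟨k', hk', rfl⟩ := List.mem_map.1 hk
  have h : IsConj k' (MulAut.conj c k') := isConj_iff.2 ⟨c, rfl⟩
  exact (hl k' hk').imp (fun h' => h'.trans h) fun h' => h'.trans h

theorem IsConjProd.inv {G : Type*} [Group G] {g : G} {n : ℕ} {x : G} (hx : IsConjProd g n x) :
    IsConjProd g n x⁻¹ := by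
  obtain ⟨l, rfl, hl, rfl⟩ := hx
  refine ⟨(l.map fun k => k⁻¹).reverse, by simp, fun k hk => ?_, (List.prod_inv_reverse l).symm⟩
  obtain ⟨k', hk', rfl⟩ := List.mem_map.1 (List.mem_reverse.1 hk)
  have hinv : ∀ {a b : G}, IsConj a b → IsConj a⁻¹ b⁻¹ := fun {a b} h => by
    obtain ⟨c, rfl⟩ := isConj_iff.1 h
    exact isConj_iff.2 ⟨c, by group⟩
  rcases hl k' hk' with h | h
  · exact Or.inr (hinv h)
  · exact Or.inl (by simpa using hinv h)

theorem isConjProd_one {G : Type*} [Group G] (g : G) (n : ℕ) : IsConjProd g (2 * n) 1 := by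
  induction n with
  | zero => exact ⟨[], rfl, by simp, rfl⟩
  | succ n ih =>
    have h : IsConjProd g 2 1 :=
      ⟨[g, g⁻¹], rfl, fun k hk => by
        rcases List.mem_pair.1 hk with rfl | rfl
        · exact Or.inl (IsConj.refl _)
        · exact Or.inr (IsConj.refl _), by simp⟩
    simpa [mul_add] using ih.mul h

theorem IsConjProd.conjWalk {g h : U ≃ᵢ U} {n : ℕ} (hh : IsConjProd g n h) (κ : ℕ → (U ≃ᵢ U))
    (i : ℕ) : IsConjProd g (i * n) (conjWalk h κ i) := by
  induction i with
  | zero =>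
    rw [Nat.zero_mul]
    exact isConjProd_one g 0
  | succ i ih =>
    have h1 := (hh.conj (κ i)⁻¹).mul ih
    rw [inv_inv] at h1
    rwa [Nat.succ_mul, add_comm]

end BoundedUrysohn

theorem propositionC {U : Type*} [MetricSpace U] (hU : BoundedUrysohn.IsBoundedUrysohn U)
    (g : U ≃ᵢ U) (hg : ∃ a : U, dist a (g a) = 1) :
    (∃ l : List (U ≃ᵢ U), l.length = 2 ^ 5 ∧ (∀ k ∈ l, IsConj g k) ∧
      BoundedUrysohn.MovesAlmostMaximally l.prod) ∧
    (∀ f : U ≃ᵢ U, ∃ l : List (U ≃ᵢ U), l.length = 2 ^ 9 ∧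
      (∀ k ∈ l, IsConj g k ∨ IsConj g⁻¹ k) ∧ l.prod = f) := by
  obtain ⟨l, hl, hconj, hd⟩ := hU.exists_list_displacesTypes hg 5
  have hmax : BoundedUrysohn.MovesAlmostMaximally l.prod :=
    hd.movesAlmostMaximally (by norm_num)
  refine ⟨⟨l, hl, hconj, hmax⟩, fun f => ?_⟩
  obtain ⟨κ, κ', rfl⟩ := hmax.exists_eq_mul_inv hU f
  have hh : BoundedUrysohn.IsConjProd g (2 ^ 5) l.prod :=
    ⟨l, hl, fun k hk => Or.inl (hconj k hk), rfl⟩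
  -- The product has `8 * 2 ^ 5 = 2 ^ 8` factors; the missing ones are supplied by `g * g⁻¹ = 1`.
  have hf := ((hh.conjWalk κ 4).mul (hh.conjWalk κ' 4).inv).mul
    (BoundedUrysohn.isConjProd_one g (2 ^ 7))
  rw [mul_one] at hf
  exact hf
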